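/- Let $a<b$, $d,T\ge 1$, let $\mathcal X=\mathcal Y=([a,b]^d)^T$ be the space of paths $x=(x_1,\dots,x_T)$, let $f:\mathcal X\to\mathbb R$ and $c:\mathcal X\times\mathcal Y\to[0,\infty)$ be continuous, and let $\mu$ be a Borel probability measure on $\mathcal X$. **Hypothesis set.** Let $\mathcal C_k\subset\mathbb R^{m_k}$ be compact, $\lambda_k\ge 0$, $L_k\in\mathbb N$, and for $l\le L_k$, $1\le t\le T-1$ let $g_{l,t}(x_{1:T};\theta')$ and $h_{l,t}(y_{1:t};\theta'')$ be jointly continuous in the path and in the parameter $\theta',\theta''\in\mathcal C_k$. Let $\Theta_k$ be the set of $\theta=(\theta',\theta'',\lambda)\in\mathcal C_k\times\mathcal C_k\times[0,\lambda_k]$, and let $C_g>0$ satisfy $|g_{l,t}(x;\theta')|\le C_g$ for all $l,t,\theta',x$. **Quantization.** Let $q=1/(T+1)$ if $d=1$ and $q=1/(dT)$ if $d\ge 2$. For $N\ge 1$ divide $[a,b]^d$ into $\lfloor N^q\rfloor^d$ disjoint cubes of equal edge length (so $N^{qd}$ cubes of edge $(b-a)/N^q$ when $N^q$ is an integer), let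 $\varphi_N$ map each cube to its center, and apply $\varphi_N$ to paths time by time; $\varphi_N^{-1}(x_{1:t})$ denotes the product of cubes that contains $x_{1:t}$. For a sample $x^1,\dots,x^N$ let $\hat\mu(dx\,|\,N,\varphi_N)=\frac1N\sum_n\delta_{\varphi_N(x^n)}$ be the adapted empirical measure, and for a product $A_t$ of cubes let $\hat\mu(dx_{t+1:T}|A_t,N,\varphi_N)$ be the uniform distribution on the $\varphi_N(x^n_{t+1:T})$ with $x^n_{1:t}\in A_t$. For $\varepsilon\in\mathbb R$ put $$D(\theta,\varepsilon;\hat\mu\circ\varphi_N^{-1})=\lambda\varepsilon+\int\sup_{y\in\mathcal Y}\Big\{f(y)-\lambda c(x,y)+\sum_{l,t}h_{l,t}(y_{1:t})\Big[g_{l,t}(x)-\int g_{l,t}(x_{1:T})\,\hat\mu(dx_{t+1:T}|\varphi_N^{-1}(x_{1:t}),N,\varphi_N)\Big]\Big\}\hat\mu(dx|N,\varphi_N),$$ $$F_\theta(x)=\sup_{y\in\mathcal Y}\Big\{f(y)-\lambda c(\varphi_N(x),y)+\sum_{l,t}h_{l,t}(y_{1:t})\Big[g_{l,t}(\varphi_N(x))-\int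 g_{l,t}(\varphi_N(x_{1:T}))\,\mu(dx_{t+1:T}|\varphi_N^{-1}(x_{1:t}))\Big]\Big\},$$ and $D(\theta,\varepsilon;\mu\circ\varphi_N^{-1})=\int F_\theta\,d\mu+\lambda\varepsilon$. **Rademacher complexity.** For a family $\mathcal G$ of functions and $n\ge1$ let $\mathcal R(\mathcal G;n)=\mathbb E\big[\sup_{g\in\mathcal G}\frac1n\sum_{i=1}^n\sigma_i g(x^i)\big]$, with $x^i$ i.i.d. from $\mu$ and $\sigma_i$ independent uniform signs. Let $\mathcal G_k\circ\varphi_N$ be the family of all $g_{l,t}(\varphi_N(\cdot);\theta')$, and $F(\Theta_k\circ\varphi_N)=\{F_\theta:\theta\in\Theta_k\}$. **Claim.** There is a constant $C>0$, independent of $N$, $\delta$ and $\varepsilon$, such that the following holds for all $N\ge 1$, $\delta\in(0,1)$ and $\varepsilon$. Suppose that $n\mapsto\mathcal R(\mathcal G_k\circ\varphi_N;n)$ is extended to a nonnegative function $\mathcal R(\mathcal G_k\circ\varphi_N;x)$ of real $x>0$ such that, with $$r(x;\delta)=2\mathcal R(\mathcal G_k\circ\varphi_N;x)+2C_g\sqrt{\frac{\ln(2/\delta)}{2x}},$$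 $x\,r(x;\delta)$ is concave on $[0,\infty)$ (with value $0$ at $x=0$) and $r(x;\delta)$ is decreasing (in the weak sense) on $(0,\infty)$. Then, with probability at least $1-\delta$ over an i.i.d. sample of size $N$ from $\mu$, $$\sup_{\theta\in\Theta_k}\big|D(\theta,\varepsilon;\mu\circ\varphi_N^{-1})-D(\theta,\varepsilon;\hat\mu\circ\varphi_N^{-1})\big|\le 2\mathcal R(F(\Theta_k\circ\varphi_N);N)+C\,\mathcal R(\mathcal G_k\circ\varphi_N;N^{1-qd(T-1)})+C\sqrt{\frac{\ln[2(NL_k(T-1)+1)/\delta]}{N^{1-qd(T-1)}}}.$$ -/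

import Mathlib

open MeasureTheory Set

noncomputable section

namespace AdaptedCOT

/-- The cube `[a, b]^d`. -/
abbrev Cube (a b : ℝ) (d : ℕ) : Type :=
  ↥(Set.Icc (fun _ : Fin d => a) (fun _ : Fin d => b))

/-- Paths `x = (x_1, ..., x_T)` with values in `[a, b]^d`. -/
abbrev Path (a b : ℝ) (d T : ℕ) : Type := Fin T → Cube a b d

/-! ### The hypothesis set -/

/-- The hypothesis set `Θ_k`: families `g_{l,t}(·; θ')` on full paths and `h_{l,t}(·; θ'')` on
initial segments `y_{1:t}`, for `l = 1, ..., L` and `t = 1, ..., T - 1`, jointly continuous in the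
parameter and the path, the parameters ranging over a compact subset `C` of `ℝ^m`, and the
multiplier `λ` ranging over `[0, lamMax]`.
The time `t ∈ {1, ..., T - 1}` is encoded by `t : Fin (T - 1)`, standing for `t + 1`. -/
structure HypothesisSet (a b : ℝ) (d T : ℕ) where
  /-- the number `L_k` of pairs of test functions per time -/
  L : ℕ
  /-- the dimension `m_k` of the parameter space -/
  m : ℕ
  /-- the compact parameter set -/
  C : Set (Fin m → ℝ)
  isCompact_C : IsCompact C
  /-- the largest multiplier `λ_k` -/
  lamMax : ℝ
  lamMax_nonneg : 0 ≤ lamMax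
  /-- the test functions in `x` -/
  g : Fin L → Fin (T - 1) → (Fin m → ℝ) → Path a b d T → ℝ
  /-- the test functions in `y_{1:t}` -/
  h : Fin L → (t : Fin (T - 1)) → (Fin m → ℝ) → (Fin (t.val + 1) → Cube a b d) → ℝ
  continuousOn_g : ∀ l t,
    ContinuousOn (fun p : (Fin m → ℝ) × Path a b d T => g l t p.1 p.2) (C ×ˢ Set.univ)
  continuousOn_h : ∀ l t,
    ContinuousOn (fun p : (Fin m → ℝ) × (Fin (t.val + 1) → Cube a b d) => h l t p.1 p.2)
      (C ×ˢ Set.univ)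

/-- The parameters `θ = (θ', θ'', λ)` of the hypothesis set. -/
def HypothesisSet.params {a b : ℝ} {d T : ℕ} (H : HypothesisSet a b d T) :
    Set ((Fin H.m → ℝ) × (Fin H.m → ℝ) × ℝ) :=
  H.C ×ˢ (H.C ×ˢ Set.Icc 0 H.lamMax)

/-- The initial segment `y_{1:t}` of a path, where `t : Fin (T - 1)` stands for `t + 1`. -/
def initSeg {a b : ℝ} {d T : ℕ} (t : Fin (T - 1)) (y : Path a b d T) :
    Fin (t.val + 1) → Cube a b d :=
  fun s => y ⟨s.val, by have h1 := s.isLt; have h2 := t.isLt; omega⟩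

/-- The path `(x_{1:t}, z_{t+1:T})`. -/
def splice {a b : ℝ} {d T : ℕ} (t : ℕ) (x z : Path a b d T) : Path a b d T :=
  fun s => if s.val < t then x s else z s

/-! ### Quantization -/

/-- The exponent `q`: `1 / (T + 1)` if `d = 1` and `1 / (d T)` if `d ≥ 2`. -/
def qExp (d T : ℕ) : ℝ := if d = 1 then 1 / ((T : ℝ) + 1) else 1 / ((d : ℝ) * (T : ℝ))

/-- The number of grid intervals along each axis: `N^q`, rounded down if it is not an integer. -/
def cellsPerAxis (d T N : ℕ) : ℕ := ⌊(N : ℝ) ^ qExp d T⌋₊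

/-- The real number `N^{1 - q d (T - 1)}`. -/
def effSize (d T N : ℕ) : ℝ := (N : ℝ) ^ (1 - qExp d T * (d : ℝ) * ((T : ℝ) - 1))

/-- Divide `[a, b]` into `M` intervals of equal length, half-open except for the last one, and
send `u` to the centre of its interval. -/
def gridCenter (a b : ℝ) (M : ℕ) (u : ℝ) : ℝ :=
  a + (((min ⌊(M : ℝ) * (u - a) / (b - a)⌋₊ (M - 1) : ℕ) : ℝ) + 1 / 2) * ((b - a) / (M : ℝ))

theorem gridCenter_mem {a b : ℝ} (hab : a ≤ b) (M : ℕ) (u : ℝ) :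
    a ≤ gridCenter a b M u ∧ gridCenter a b M u ≤ b := by
  unfold gridCenter
  set j : ℕ := min ⌊(M : ℝ) * (u - a) / (b - a)⌋₊ (M - 1) with hj
  have hw : 0 ≤ (b - a) / (M : ℝ) := div_nonneg (by linarith) (Nat.cast_nonneg _)
  refine ⟨?_, ?_⟩
  · have : 0 ≤ ((j : ℝ) + 1 / 2) * ((b - a) / (M : ℝ)) := by positivity
    linarith
  · rcases Nat.eq_zero_or_pos M with hM | hM
    · simp [hM, hab]
    · have hjM : j + 1 ≤ M := by
        have : j ≤ M - 1 := min_le_right _ _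
        omega
      have hjM' : (j : ℝ) + 1 ≤ (M : ℝ) := by exact_mod_cast hjM
      have hMpos : (0 : ℝ) < M := by exact_mod_cast hM
      have h1 : ((j : ℝ) + 1 / 2) * ((b - a) / (M : ℝ)) ≤ (M : ℝ) * ((b - a) / (M : ℝ)) :=
        mul_le_mul_of_nonneg_right (by linarith) hw
      have h2 : (M : ℝ) * ((b - a) / (M : ℝ)) = b - a := by field_simp
      linarith

/-- The map `φ_N` on `[a, b]^d`: each grid cube is sent to its centre. -/
def quantPoint {a b : ℝ} {d : ℕ} (M : ℕ) (u : Cube a b d) : Cube a b d :=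
  ⟨fun i => gridCenter a b M (u.1 i),
    fun i => (gridCenter_mem ((u.2.1 i).trans (u.2.2 i)) M (u.1 i)).1,
    fun i => (gridCenter_mem ((u.2.1 i).trans (u.2.2 i)) M (u.1 i)).2⟩

/-- The map `φ_N` applied to a path, time by time. -/
def quant {a b : ℝ} {d T : ℕ} (N : ℕ) (x : Path a b d T) : Path a b d T :=
  fun s => quantPoint (cellsPerAxis d T N) (x s)

/-- The event that the segment `z_{1:t}` lies in the same product `A_t` of grid cubes as
`x_{1:t}`. -/
def cell {a b : ℝ} {d T : ℕ} (N t : ℕ) (x : Path a b d T) : Set (Path a b d T) :=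
  {z | ∀ s : Fin T, s.val < t →
    quantPoint (cellsPerAxis d T N) (z s) = quantPoint (cellsPerAxis d T N) (x s)}

/-! ### Adapted empirical measures -/

/-- The adapted empirical measure `N⁻¹ ∑ₙ δ_{φ_N(xⁿ)}`. -/
def adaptedEmpirical {a b : ℝ} {d T : ℕ} (N : ℕ) (X : Fin N → Path a b d T) :
    Measure (Path a b d T) :=
  ((N : ENNReal))⁻¹ • ∑ n : Fin N, Measure.dirac (quant N (X n))

open Classical in
/-- The adapted empirical conditional measure given an event `A` on the path up to time `t`: the
uniform distribution on the quantized sample paths that fall into `A`. It is kept as a law of full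
paths; only its marginal on the times after `t` is used. -/
def adaptedConditional {a b : ℝ} {d T : ℕ} (N : ℕ) (X : Fin N → Path a b d T)
    (A : Set (Path a b d T)) : Measure (Path a b d T) :=
  (((Finset.univ.filter fun n : Fin N => X n ∈ A).card : ENNReal))⁻¹ •
    ∑ n ∈ Finset.univ.filter (fun n : Fin N => X n ∈ A), Measure.dirac (quant N (X n))

/-! ### The dual objective -/

/-- `sup_y { f(y) - λ c(x, y) + ∑_{l,t} h_{l,t}(y_{1:t}) [g_{l,t}(x) - κ_{l,t}] }`. -/
def innerSup {a b : ℝ} {d T : ℕ} (f : Path a b d T → ℝ) (c : Path a b d T → Path a b d T → ℝ)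
    (H : HypothesisSet a b d T) (θ : (Fin H.m → ℝ) × (Fin H.m → ℝ) × ℝ) (x : Path a b d T)
    (κ : Fin H.L → Fin (T - 1) → ℝ) : ℝ :=
  ⨆ y : Path a b d T, (f y - θ.2.2 * c x y +
    ∑ l : Fin H.L, ∑ t : Fin (T - 1),
      H.h l t θ.2.1 (initSeg t y) * (H.g l t θ.1 x - κ l t))

/-- The function `F` composed with `φ_N`, where the conditional expectations of
`g_{l,t}(φ_N(x_{1:T}))` are taken under `μ(dx_{t+1:T} | φ_N⁻¹(x_{1:t}))`, the law of the future
given that the past lies in the grid cell of `x_{1:t}`. -/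
def quantF {a b : ℝ} {d T : ℕ} (f : Path a b d T → ℝ) (c : Path a b d T → Path a b d T → ℝ)
    (H : HypothesisSet a b d T) (μ : Measure (Path a b d T)) (N : ℕ)
    (θ : (Fin H.m → ℝ) × (Fin H.m → ℝ) × ℝ) (x : Path a b d T) : ℝ :=
  innerSup f c H θ (quant N x) fun l t =>
    ∫ z, H.g l t θ.1 (quant N (splice (t.val + 1) x z))
      ∂(ProbabilityTheory.cond μ (cell N (t.val + 1) x))

/-- `D(θ, ε; μ ∘ φ_N⁻¹)`. -/
def dualTrue {a b : ℝ} {d T : ℕ} (f : Path a b d T → ℝ) (c : Path a b d T → Path a b d T → ℝ)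
    (H : HypothesisSet a b d T) (μ : Measure (Path a b d T)) (N : ℕ)
    (θ : (Fin H.m → ℝ) × (Fin H.m → ℝ) × ℝ) (ε : ℝ) : ℝ :=
  (∫ x, quantF f c H μ N θ x ∂μ) + θ.2.2 * ε

/-- `D(θ, ε; μ̂ ∘ φ_N⁻¹)` for the sample `X`, with the adapted empirical measure and its adapted
empirical conditional measures. -/
def dualAdapted {a b : ℝ} {d T : ℕ} (f : Path a b d T → ℝ)
    (c : Path a b d T → Path a b d T → ℝ)
    (H : HypothesisSet a b d T) (N : ℕ) (X : Fin N → Path a b d T)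
    (θ : (Fin H.m → ℝ) × (Fin H.m → ℝ) × ℝ) (ε : ℝ) : ℝ :=
  (∫ x, innerSup f c H θ x (fun l t =>
      ∫ z, H.g l t θ.1 (splice (t.val + 1) x z)
        ∂(adaptedConditional N X (cell N (t.val + 1) x)))
    ∂(adaptedEmpirical N X)) + θ.2.2 * ε

/-! ### Rademacher complexity -/

/-- The empirical Rademacher complexity of `G` on the sample `S`: the mean over uniform signs
`σ ∈ {-1, 1}^n` of `sup_{g ∈ G} n⁻¹ ∑ᵢ σᵢ g(Sᵢ)`. -/
def empiricalRademacher {E : Type*} (G : Set (E → ℝ)) (n : ℕ) (S : Fin n → E) : ℝ :=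
  ((2 : ℝ) ^ n)⁻¹ * ∑ σ : Fin n → ℤˣ,
    ⨆ g : G, (n : ℝ)⁻¹ * ∑ i : Fin n, ((σ i : ℤ) : ℝ) * (g : E → ℝ) (S i)

/-- The Rademacher complexity: the mean of the empirical one over i.i.d. samples from `μ`. -/
def rademacher {E : Type*} [MeasurableSpace E] (μ : Measure E) (G : Set (E → ℝ)) (n : ℕ) : ℝ :=
  ∫ S, empiricalRademacher G n S ∂(Measure.pi fun _ : Fin n => μ)

/-- The family `G_k ∘ φ_N` of all functions `x ↦ g_{l,t}(φ_N(x); θ')`. -/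
def classG {a b : ℝ} {d T : ℕ} (H : HypothesisSet a b d T) (N : ℕ) : Set (Path a b d T → ℝ) :=
  {u | ∃ l t, ∃ θ ∈ H.C, u = fun x => H.g l t θ (quant N x)}

/-- The family `F(Θ_k ∘ φ_N)`. -/
def classF {a b : ℝ} {d T : ℕ} (f : Path a b d T → ℝ) (c : Path a b d T → Path a b d T → ℝ)
    (H : HypothesisSet a b d T) (μ : Measure (Path a b d T)) (N : ℕ) :
    Set (Path a b d T → ℝ) :=
  {u | ∃ θ ∈ H.params, u = quantF f c H μ N θ}

/-- `ρ` is a nonnegative extension to real sample sizes of a complexity `R` that is defined for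
positive integers. -/
def IsSizeExtension (R : ℕ → ℝ) (ρ : ℝ → ℝ) : Prop :=
  (∀ n : ℕ, 1 ≤ n → ρ n = R n) ∧ ∀ x : ℝ, 0 < x → 0 ≤ ρ x

/-- `r(x; δ) = 2 ρ(x) + 2 C_g √(ln(2/δ) / (2x))` (for `x > 0`). -/
def rFun (ρ : ℝ → ℝ) (Cg δ x : ℝ) : ℝ :=
  2 * ρ x + 2 * Cg * Real.sqrt (Real.log (2 / δ) / (2 * x))

end AdaptedCOT

end

/-!
The error of the dual objective has two sources: the empirical mean of `F_θ` replaces its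
expectation, and empirical conditional expectations replace the true ones inside the supremum
over `y`. The latter supremum is Lipschitz in the conditional expectations, so everything reduces
to `|∫ F_θ dμ - N⁻¹ ∑ₙ F_θ(xⁿ)|` and, for each `t`, to the mean over the sample of the deviation
between the true and the empirical conditional mean of `g_{l,t}(·; θ')` given the grid cell of
`x_{1:t}` (`abs_dualTrue_sub_dualAdapted_le`).

For the second quantity the cells are not treated one at a time. The sum over the cells of the
absolute deviations, weighted by the cell counts, is the maximum over signs `s` of the cells of
`N⁻¹ ∑ₙ s(cell xⁿ) (E[g | cell xⁿ] - g(xⁿ))` (`exists_signs_sum_abs`). For fixed `s` this is a centred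
empirical process. Its supremum over `θ` has mean at most `2 R(G; N)`, by symmetrization with a copy
of the sample that is conditionally independent given the cells (`symmetrization`): the signs `s`
are absorbed by the Rademacher signs. McDiarmid's inequality (`pexp_mcdiarmid`) bounds the
fluctuations, and a union bound over `t` and `s` costs `√(k / N)`, where `k` is the number of cells.
As `k ≤ N / N^{1 - q d (T - 1)}`, this is of the order of the last term of the claim
(`log_numEvents_div_le`). The ordinary symmetrization inequality for `F_θ` is the case of one cell.
Since `r` is decreasing, `R(G; N)` is at most the complexity at `N^{1 - q d (T - 1)}` plus a
fluctuation term (`le_of_antitoneOn_rFun`).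

After quantization, all functions of a path depend on its code in a finite set of grid cells, so that
the probabilistic part takes place on finite products with finite weights, and no measurability
question arises for suprema over `θ`.
-/

noncomputable section

namespace AdaptedCOT

/-! ### Concentration for finite product weights -/

section FiniteProduct

variable {E : Type*} [Fintype E]

/-- The expectation of `Φ(X_1, …, X_n)` when the `X_i` are independent with weights `p` on the
finite set `E`. No normalisation of `p` is built in. -/
def pexp (p : E → ℝ) {n : ℕ} (Φ : (Fin n → E) → ℝ) : ℝ :=
  ∑ X : Fin n → E, (∏ i, p (X i)) * Φ X

theorem pexp_mono {p : E → ℝ} (hp : ∀ e, 0 ≤ p e) {n : ℕ} {Φ Ψ : (Fin n → E) → ℝ}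
    (h : ∀ X, Φ X ≤ Ψ X) : pexp p Φ ≤ pexp p Ψ :=
  Finset.sum_le_sum fun X _ =>
    mul_le_mul_of_nonneg_left (h X) (Finset.prod_nonneg fun i _ => hp (X i))

theorem pexp_const_mul (p : E → ℝ) {n : ℕ} (r : ℝ) (Φ : (Fin n → E) → ℝ) :
    pexp p (fun X => r * Φ X) = r * pexp p Φ := by
  unfold pexp
  rw [Finset.mul_sum]
  exact Finset.sum_congr rfl fun X _ => by ring

theorem pexp_const {p : E → ℝ} (hp1 : ∑ e, p e = 1) (n : ℕ) (r : ℝ) :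
    pexp p (fun _ : Fin n → E => r) = r := by
  unfold pexp
  rw [← Finset.sum_mul, ← Fintype.sum_pow, hp1, one_pow, one_mul]

theorem pexp_sub (p : E → ℝ) {n : ℕ} (Φ Ψ : (Fin n → E) → ℝ) :
    pexp p (fun X => Φ X - Ψ X) = pexp p Φ - pexp p Ψ := by
  unfold pexp
  rw [← Finset.sum_sub_distrib]
  exact Finset.sum_congr rfl fun X _ => by ring

theorem pexp_succ (p : E → ℝ) {n : ℕ} (Φ : (Fin (n + 1) → E) → ℝ) :
    pexp p Φ = ∑ e, p e * pexp p (fun X : Fin n → E => Φ (Fin.cons e X)) := by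
  unfold pexp
  rw [← Fintype.sum_equiv (Fin.consEquiv fun _ : Fin (n + 1) => E)
    (fun z => (∏ i, p ((Fin.cons z.1 z.2 : Fin (n + 1) → E) i)) * Φ (Fin.cons z.1 z.2)) _
    (fun z => rfl), Fintype.sum_prod_type]
  refine Finset.sum_congr rfl fun e _ => ?_
  rw [Finset.mul_sum]
  refine Finset.sum_congr rfl fun X _ => ?_
  simp only [Fin.prod_univ_succ, Fin.cons_zero, Fin.cons_succ]
  ring

/-- Hoeffding's lemma for a centred variable with values in `[-c, c]`. -/
theorem sum_mul_exp_le {p : E → ℝ} (hp : ∀ e, 0 ≤ p e) (hp1 : ∑ e, p e = 1) {c : ℝ} (hc : 0 < c)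
    {y : E → ℝ} (hy : ∀ e, |y e| ≤ c) (hmean : ∑ e, p e * y e = 0) (l : ℝ) :
    ∑ e, p e * Real.exp (l * y e) ≤ Real.exp (l ^ 2 * c ^ 2 / 2) := by
  have h : ∀ e, p e * Real.exp (l * y e) ≤
      p e * Real.cosh (l * c) + (p e * y e) * (Real.sinh (l * c) / c) := by
    intro e
    have ht : |y e / c| ≤ 1 := by
      rw [abs_div, abs_of_pos hc, div_le_one hc]
      exact hy e
    have h1 := mul_le_mul_of_nonneg_left (Real.exp_mul_le_cosh_add_mul_sinh ht (l * c)) (hp e)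
    have h2 : y e / c * (l * c) = l * y e := by field_simp
    rw [h2] at h1
    refine h1.trans_eq ?_
    ring
  calc ∑ e, p e * Real.exp (l * y e)
      ≤ ∑ e, (p e * Real.cosh (l * c) + (p e * y e) * (Real.sinh (l * c) / c)) :=
        Finset.sum_le_sum fun e _ => h e
    _ = Real.cosh (l * c) := by
        rw [Finset.sum_add_distrib, ← Finset.sum_mul, ← Finset.sum_mul, hp1, hmean]
        ring
    _ ≤ Real.exp ((l * c) ^ 2 / 2) := Real.cosh_le_exp_half_sq _
    _ = Real.exp (l ^ 2 * c ^ 2 / 2) := by rw [mul_pow]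

/-- The exponential moment bound behind McDiarmid's inequality, by induction on the number of
coordinates: integrating out all coordinates but the first leaves a function of one variable of
oscillation at most `c`. -/
theorem pexp_exp_le {p : E → ℝ} (hp : ∀ e, 0 ≤ p e) (hp1 : ∑ e, p e = 1) {c : ℝ} (hc : 0 < c)
    (l : ℝ) (n : ℕ) (Φ : (Fin n → E) → ℝ)
    (hΦ : ∀ X i e, |Φ (Function.update X i e) - Φ X| ≤ c) :
    pexp p (fun X => Real.exp (l * (Φ X - pexp p Φ))) ≤ Real.exp (n * (l ^ 2 * c ^ 2 / 2)) := by
  induction n with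
  | zero => simp [pexp]
  | succ n ih =>
    set m : E → ℝ := fun e => pexp p (fun X : Fin n → E => Φ (Fin.cons e X)) with hm
    have hmean : pexp p Φ = ∑ e, p e * m e := pexp_succ p Φ
    have hosc : ∀ e e', |m e - m e'| ≤ c := by
      have key : ∀ e e', m e - m e' ≤ c := by
        intro e e'
        rw [hm]
        dsimp only
        rw [← pexp_sub]
        refine (pexp_mono hp fun X => ?_).trans_eq (pexp_const hp1 n c)
        have h1 := hΦ (Fin.cons e' X) 0 e
        rw [Fin.update_cons_zero] at h1
        exact (le_abs_self _).trans h1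
      intro e e'
      rw [abs_le]
      constructor <;> linarith [key e e', key e' e]
    have hdev : ∀ e, |m e - pexp p Φ| ≤ c := by
      intro e
      have h1 : m e - pexp p Φ = ∑ e', p e' * (m e - m e') := by
        simp only [mul_sub, Finset.sum_sub_distrib]
        rw [← Finset.sum_mul, hp1, one_mul, hmean]
      rw [h1]
      refine (Finset.abs_sum_le_sum_abs _ _).trans ?_
      calc ∑ e', |p e' * (m e - m e')| ≤ ∑ e', p e' * c :=
            Finset.sum_le_sum fun e' _ => by
              rw [abs_mul, abs_of_nonneg (hp e')]
              exact mul_le_mul_of_nonneg_left (hosc e e') (hp e')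
        _ = c := by rw [← Finset.sum_mul, hp1, one_mul]
    have hcentre : ∑ e, p e * (m e - pexp p Φ) = 0 := by
      simp only [mul_sub, Finset.sum_sub_distrib]
      rw [← Finset.sum_mul, hp1, one_mul, hmean, sub_self]
    rw [pexp_succ]
    calc ∑ e, p e * pexp p (fun X : Fin n → E =>
            Real.exp (l * (Φ (Fin.cons e X) - pexp p Φ)))
        ≤ ∑ e, p e * (Real.exp (l * (m e - pexp p Φ)) * Real.exp (n * (l ^ 2 * c ^ 2 / 2))) := by
          refine Finset.sum_le_sum fun e _ => mul_le_mul_of_nonneg_left ?_ (hp e)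
          have h1 : ∀ X : Fin n → E, Real.exp (l * (Φ (Fin.cons e X) - pexp p Φ)) =
              Real.exp (l * (m e - pexp p Φ)) * Real.exp (l * (Φ (Fin.cons e X) - m e)) := by
            intro X
            rw [← Real.exp_add]
            congr 1
            ring
          simp only [h1]
          rw [pexp_const_mul]
          refine mul_le_mul_of_nonneg_left ?_ (Real.exp_pos _).le
          refine ih (fun X => Φ (Fin.cons e X)) fun X i e' => ?_
          have h2 := hΦ (Fin.cons e X) i.succ e'
          rw [← Fin.cons_update] at h2
          exact h2
      _ = (∑ e, p e * Real.exp (l * (m e - pexp p Φ))) * Real.exp (n * (l ^ 2 * c ^ 2 / 2)) := by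
          rw [Finset.sum_mul]
          exact Finset.sum_congr rfl fun e _ => by ring
      _ ≤ Real.exp (l ^ 2 * c ^ 2 / 2) * Real.exp (n * (l ^ 2 * c ^ 2 / 2)) :=
          mul_le_mul_of_nonneg_right (sum_mul_exp_le hp hp1 hc hdev hcentre l)
            (Real.exp_pos _).le
      _ = Real.exp ((n + 1 : ℕ) * (l ^ 2 * c ^ 2 / 2)) := by
          rw [← Real.exp_add]
          congr 1
          push_cast
          ring

open Classical in
/-- McDiarmid's inequality for finite product weights, with a constant that is not optimal. -/
theorem pexp_mcdiarmid {p : E → ℝ} (hp : ∀ e, 0 ≤ p e) (hp1 : ∑ e, p e = 1) {c : ℝ} (hc : 0 < c)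
    {n : ℕ} (hn : 0 < n) (Φ : (Fin n → E) → ℝ)
    (hΦ : ∀ X i e, |Φ (Function.update X i e) - Φ X| ≤ c) {r : ℝ} (hr : 0 ≤ r) :
    pexp p (fun X => if pexp p Φ + r < Φ X then 1 else 0) ≤
      Real.exp (-(r ^ 2 / (2 * n * c ^ 2))) := by
  have hn' : (0 : ℝ) < n := by exact_mod_cast hn
  -- the minimiser of the Chernoff exponent `n l² c² / 2 - l r`
  set l : ℝ := r / (n * c ^ 2) with hl
  have hl0 : 0 ≤ l := by positivity
  calc pexp p (fun X => if pexp p Φ + r < Φ X then (1 : ℝ) else 0)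
      ≤ pexp p (fun X => Real.exp (-(l * r)) * Real.exp (l * (Φ X - pexp p Φ))) := by
        refine pexp_mono hp fun X => ?_
        split_ifs with h
        · rw [← Real.exp_add]
          refine Real.one_le_exp ?_
          have : 0 ≤ l * (Φ X - pexp p Φ - r) := mul_nonneg hl0 (by linarith)
          linarith
        · positivity
    _ ≤ Real.exp (-(l * r)) * Real.exp (n * (l ^ 2 * c ^ 2 / 2)) := by
        rw [pexp_const_mul]
        exact mul_le_mul_of_nonneg_left (pexp_exp_le hp hp1 hc l n Φ hΦ) (Real.exp_pos _).le
    _ = Real.exp (-(r ^ 2 / (2 * n * c ^ 2))) := by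
        rw [← Real.exp_add]
        congr 1
        rw [hl]
        field_simp
        ring

end FiniteProduct

/-! ### Suprema of sample means -/

section SupMean

variable {ι : Type*}

/-- `sup_i n⁻¹ ∑ⱼ w_{i,j}`. -/
def supMean {n : ℕ} (w : ι → Fin n → ℝ) : ℝ := ⨆ i, (n : ℝ)⁻¹ * ∑ j, w i j

theorem bddAbove_mean {n : ℕ} {w : ι → Fin n → ℝ} {B : ℝ} (hw : ∀ i j, |w i j| ≤ B) :
    BddAbove (Set.range fun i => (n : ℝ)⁻¹ * ∑ j, w i j) := by
  refine ⟨(n : ℝ)⁻¹ * ∑ _j : Fin n, B, ?_⟩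
  rintro _ ⟨i, rfl⟩
  exact mul_le_mul_of_nonneg_left
    (Finset.sum_le_sum fun j _ => (le_abs_self _).trans (hw i j)) (by positivity)

theorem mean_le_supMean {n : ℕ} {w : ι → Fin n → ℝ} {B : ℝ} (hw : ∀ i j, |w i j| ≤ B) (i : ι) :
    (n : ℝ)⁻¹ * ∑ j, w i j ≤ supMean w :=
  le_ciSup (bddAbove_mean hw) i

theorem supMean_add_le [Nonempty ι] {n : ℕ} {u v : ι → Fin n → ℝ} {B : ℝ}
    (hu : ∀ i j, |u i j| ≤ B) (hv : ∀ i j, |v i j| ≤ B) :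
    supMean (fun i j => u i j + v i j) ≤ supMean u + supMean v := by
  refine ciSup_le fun i => ?_
  rw [Finset.sum_add_distrib, mul_add]
  exact add_le_add (mean_le_supMean hu i) (mean_le_supMean hv i)

/-- Changing one of the `n` terms by at most `b` changes the supremum of the means by at most
`b / n`. -/
theorem abs_supMean_sub_le [Nonempty ι] {n : ℕ} {u v : ι → Fin n → ℝ} {B b : ℝ}
    (hu : ∀ i j, |u i j| ≤ B) (hv : ∀ i j, |v i j| ≤ B) (k : Fin n)
    (hne : ∀ i j, j ≠ k → u i j = v i j) (hk : ∀ i, |u i k - v i k| ≤ b) :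
    |supMean u - supMean v| ≤ (n : ℝ)⁻¹ * b := by
  have key : ∀ u v : ι → Fin n → ℝ, (∀ i j, |v i j| ≤ B) →
      (∀ i j, j ≠ k → u i j = v i j) → (∀ i, |u i k - v i k| ≤ b) →
      supMean u ≤ supMean v + (n : ℝ)⁻¹ * b := by
    intro u v hv hne hk
    refine ciSup_le fun i => ?_
    refine le_trans ?_ (add_le_add_left (mean_le_supMean hv i) _)
    rw [← mul_add]
    refine mul_le_mul_of_nonneg_left ?_ (by positivity)
    have h1 : ∑ j, u i j - ∑ j, v i j = u i k - v i k := by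
      rw [← Finset.sum_sub_distrib]
      refine Finset.sum_eq_single k (fun j _ hj => ?_) (fun h => absurd (Finset.mem_univ k) h)
      rw [hne i j hj, sub_self]
    linarith [(le_abs_self _).trans (hk i)]
  rw [abs_le]
  constructor
  · have := key v u hu (fun i j hj => (hne i j hj).symm)
      (fun i => by rw [abs_sub_comm]; exact hk i)
    linarith
  · have := key u v hv hne hk
    linarith

end SupMean

theorem abs_sign (u : ℤˣ) : |((u : ℤ) : ℝ)| = 1 := by
  rcases Int.units_eq_one_or u with h | h <;> simp [h]

theorem abs_sign_mul (u : ℤˣ) (x : ℝ) : |((u : ℤ) : ℝ) * x| = |x| := by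
  rw [abs_mul, abs_sign, one_mul]

/-! ### Symmetrization -/

section Symmetrization

variable {E ι : Type*}

/-- Exchange `X_j` and `Y_j` at the indices `j` with `σ_j = -1`. -/
def signSwap {n : ℕ} (σ : Fin n → ℤˣ) (z : (Fin n → E) × (Fin n → E)) :
    (Fin n → E) × (Fin n → E) :=
  (fun j => if σ j = 1 then z.1 j else z.2 j, fun j => if σ j = 1 then z.2 j else z.1 j)

theorem signSwap_involutive {n : ℕ} (σ : Fin n → ℤˣ) :
    Function.Involutive (signSwap (E := E) σ) := by
  intro z
  refine Prod.ext ?_ ?_ <;> funext j <;> by_cases h : σ j = 1 <;> simp [signSwap, h]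

/-- Multiplying the terms by signs that are a function of the sample does not change the
mean over uniform signs. -/
theorem sum_sign_supMean_mul {n : ℕ} (τ : Fin n → ℤˣ) (u : ι → Fin n → ℝ) :
    ∑ σ : Fin n → ℤˣ, supMean (fun i j => ((σ j : ℤ) : ℝ) * (((τ j : ℤ) : ℝ) * u i j)) =
      ∑ σ : Fin n → ℤˣ, supMean (fun i j => ((σ j : ℤ) : ℝ) * u i j) := by
  refine Fintype.sum_equiv (Equiv.mulRight τ) _ _ fun σ => ?_
  congr 1
  funext i j
  simp only [Equiv.coe_mulRight, Pi.mul_apply, Units.val_mul, Int.cast_mul]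
  ring

variable [Fintype E]

theorem sum_prod_joint {p : E → ℝ} {Q : E → E → ℝ} (hQp : ∀ e, ∑ e', Q e e' = p e) {n : ℕ}
    (X : Fin n → E) : ∑ Y : Fin n → E, ∏ j, Q (X j) (Y j) = ∏ j, p (X j) := by
  rw [← Fintype.prod_sum fun j e' => Q (X j) e']
  exact Finset.prod_congr rfl fun j _ => hQp _

theorem sum_prod_joint_mul {p : E → ℝ} {Q : E → E → ℝ} (hQp : ∀ e, ∑ e', Q e e' = p e)
    {g gbar : E → ℝ} (hQg : ∀ e, ∑ e', Q e e' * g e' = p e * gbar e) {n : ℕ}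
    (X : Fin n → E) (k : Fin n) :
    ∑ Y : Fin n → E, (∏ j, Q (X j) (Y j)) * g (Y k) = (∏ j, p (X j)) * gbar (X k) := by
  have h1 : ∀ Y : Fin n → E, (∏ j, Q (X j) (Y j)) * g (Y k) =
      ∏ j, (Q (X j) (Y j) * if j = k then g (Y j) else 1) := by
    intro Y
    rw [Finset.prod_mul_distrib, Finset.prod_ite_eq' Finset.univ k fun j => g (Y j)]
    simp
  have h2 : (∏ j, p (X j)) * gbar (X k) = ∏ j, (p (X j) * if j = k then gbar (X j) else 1) := by
    rw [Finset.prod_mul_distrib, Finset.prod_ite_eq' Finset.univ k fun j => gbar (X j)]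
    simp
  rw [h2, Finset.sum_congr rfl fun Y _ => h1 Y,
    ← Fintype.prod_sum fun j e' => Q (X j) e' * if j = k then g e' else 1]
  refine Finset.prod_congr rfl fun j _ => ?_
  by_cases hj : j = k
  · simp only [hj, if_true]
    exact hQg _
  · simp only [hj, if_false, mul_one]
    exact hQp _

/-- Symmetrization along a reversible coupling. `Q` is the law of an exchangeable pair `(X, Y)`
with marginals `p`, `gbar i` is the conditional mean of `g i (Y)` given `X`, and `s` is a function
of signs that takes the same value at `X` and `Y`. The two cases of interest are an independent
pair, which gives the usual symmetrization inequality, and a pair that is conditionally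
independent given the cell of a partition, `s` being a choice of signs for the cells. -/
theorem symmetrization [Nonempty ι] {p : E → ℝ} {Q : E → E → ℝ} (hQ0 : ∀ e e', 0 ≤ Q e e')
    (hQs : ∀ e e', Q e e' = Q e' e) (hQp : ∀ e, ∑ e', Q e e' = p e) {g gbar : ι → E → ℝ} {B : ℝ}
    (hg : ∀ i e, |g i e| ≤ B)
    (hQg : ∀ i e, ∑ e', Q e e' * g i e' = p e * gbar i e)
    (s : E → ℤˣ) (hs : ∀ e e', Q e e' ≠ 0 → s e = s e') (n : ℕ) :
    pexp p (fun X : Fin n → E =>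
        supMean fun i j => ((s (X j) : ℤ) : ℝ) * (gbar i (X j) - g i (X j))) ≤
      2 * pexp p (fun X : Fin n → E => ((2 : ℝ) ^ n)⁻¹ *
        ∑ σ : Fin n → ℤˣ, supMean fun i j => ((σ j : ℤ) : ℝ) * g i (X j)) := by
  have hp : ∀ e, 0 ≤ p e := fun e => by
    rw [← hQp]; exact Finset.sum_nonneg fun e' _ => hQ0 e e'
  set W : (Fin n → E) → (Fin n → E) → ℝ := fun X Y => ∏ j, Q (X j) (Y j) with hW
  have hW0 : ∀ X Y, 0 ≤ W X Y := fun X Y => Finset.prod_nonneg fun j _ => hQ0 _ _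
  have hWs : ∀ X Y, W X Y = W Y X := fun X Y => Finset.prod_congr rfl fun j _ => hQs _ _
  have hWp : ∀ X, ∑ Y, W X Y = ∏ j, p (X j) := fun X => sum_prod_joint hQp X
  -- the symmetrized process, for a fixed choice of signs
  set D : (Fin n → ℤˣ) → (Fin n → E) × (Fin n → E) → ℝ := fun σ z =>
    supMean fun i j => ((σ j : ℤ) : ℝ) * (((s (z.1 j) : ℤ) : ℝ) * (g i (z.2 j) - g i (z.1 j)))
    with hD
  have habs : ∀ x y : ℝ, |x| ≤ B → |y| ≤ B → |x - y| ≤ 2 * B := fun x y hx hy =>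
    (abs_sub _ _).trans (by linarith)
  have step1 : pexp p (fun X : Fin n → E =>
        supMean fun i j => ((s (X j) : ℤ) : ℝ) * (gbar i (X j) - g i (X j))) ≤
      ∑ z : (Fin n → E) × (Fin n → E), W z.1 z.2 * D 1 z := by
    rw [Fintype.sum_prod_type]
    refine Finset.sum_le_sum fun X _ => ?_
    unfold supMean
    rw [Real.mul_iSup_of_nonneg (Finset.prod_nonneg fun j _ => hp _)]
    refine ciSup_le fun i => ?_
    have h1 : (∏ j, p (X j)) * ((n : ℝ)⁻¹ *
          ∑ j, ((s (X j) : ℤ) : ℝ) * (gbar i (X j) - g i (X j))) =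
        ∑ Y, W X Y * ((n : ℝ)⁻¹ * ∑ j, ((s (X j) : ℤ) : ℝ) * (g i (Y j) - g i (X j))) := by
      have h2 : ∀ j, ∑ Y, W X Y * (((s (X j) : ℤ) : ℝ) * (g i (Y j) - g i (X j))) =
          (∏ j, p (X j)) * (((s (X j) : ℤ) : ℝ) * (gbar i (X j) - g i (X j))) := by
        intro j
        have h3 := sum_prod_joint_mul hQp (hQg i) X j
        calc ∑ Y, W X Y * (((s (X j) : ℤ) : ℝ) * (g i (Y j) - g i (X j)))
            = ((s (X j) : ℤ) : ℝ) * (∑ Y, W X Y * g i (Y j))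
              - ((s (X j) : ℤ) : ℝ) * ((∑ Y, W X Y) * g i (X j)) := by
              rw [Finset.sum_mul, Finset.mul_sum, Finset.mul_sum, ← Finset.sum_sub_distrib]
              exact Finset.sum_congr rfl fun Y _ => by ring
          _ = _ := by
              rw [h3, hWp]
              ring
      rw [mul_left_comm, Finset.mul_sum]
      simp only [← h2]
      rw [Finset.sum_comm, Finset.mul_sum]
      refine Finset.sum_congr rfl fun Y _ => ?_
      rw [← Finset.mul_sum]
      ring
    rw [h1]
    refine Finset.sum_le_sum fun Y _ => mul_le_mul_of_nonneg_left ?_ (hW0 X Y)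
    simp only [hD, Pi.one_apply, Units.val_one, Int.cast_one, one_mul]
    refine mean_le_supMean (B := 2 * B) (w := fun i j =>
      ((s (X j) : ℤ) : ℝ) * (g i (Y j) - g i (X j))) (fun i j => ?_) i
    rw [abs_sign_mul]
    exact habs _ _ (hg _ _) (hg _ _)
  have hsign : ∀ z : (Fin n → E) × (Fin n → E), W z.1 z.2 ≠ 0 → ∀ j, s (z.1 j) = s (z.2 j) := fun z hz j =>
    hs _ _ (Finset.prod_ne_zero_iff.1 hz j (Finset.mem_univ j))
  have step2 : ∀ σ, ∑ z : (Fin n → E) × (Fin n → E), W z.1 z.2 * D 1 z =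
      ∑ z : (Fin n → E) × (Fin n → E), W z.1 z.2 * D σ z := by
    intro σ
    rw [← Equiv.sum_comp (signSwap_involutive σ).toPerm]
    refine Finset.sum_congr rfl fun z _ => ?_
    simp only [Function.Involutive.coe_toPerm]
    have hWswap : W (signSwap σ z).1 (signSwap σ z).2 = W z.1 z.2 := by
      refine Finset.prod_congr rfl fun j _ => ?_
      by_cases h : σ j = 1
      · simp [signSwap, h]
      · simp only [signSwap, h, if_false]
        exact hQs _ _
    rw [hWswap]
    by_cases hz : W z.1 z.2 = 0
    · rw [hz, zero_mul, zero_mul]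
    · congr 1
      simp only [hD]
      congr 1
      funext i j
      have h1 := hsign z hz j
      rcases Int.units_eq_one_or (σ j) with h | h
      · simp [signSwap, h]
      · have hne : ((-1 : ℤˣ) = 1) = False := by simp
        simp only [signSwap, h, hne, if_false, Pi.one_apply, h1, Units.val_one, Units.val_neg]
        push_cast
        ring
  have step3 : ∀ σ, ∑ z : (Fin n → E) × (Fin n → E), W z.1 z.2 * D σ z ≤
      pexp p (fun X => supMean fun i j => ((σ j : ℤ) : ℝ) * (((s (X j) : ℤ) : ℝ) * g i (X j))) +
      pexp p (fun X => supMean fun i j =>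
        ((σ j : ℤ) : ℝ) * (((-s (X j) : ℤˣ) : ℤ) * g i (X j))) := by
    intro σ
    have hfst : ∀ Φ : (Fin n → E) → ℝ,
        ∑ z : (Fin n → E) × (Fin n → E), W z.1 z.2 * Φ z.1 = pexp p Φ := by
      intro Φ
      rw [Fintype.sum_prod_type]
      refine Finset.sum_congr rfl fun X _ => ?_
      rw [← hWp X, Finset.sum_mul]
    have hsnd : ∀ Φ : (Fin n → E) → ℝ,
        ∑ z : (Fin n → E) × (Fin n → E), W z.1 z.2 * Φ z.2 = pexp p Φ := by
      intro Φ
      rw [← hfst Φ]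
      refine Fintype.sum_equiv (Equiv.prodComm _ _) _ _ fun z => ?_
      simp only [Equiv.prodComm_apply, Prod.fst_swap, Prod.snd_swap]
      rw [hWs]
    rw [← hsnd, ← hfst, ← Finset.sum_add_distrib]
    refine Finset.sum_le_sum fun z _ => ?_
    rw [← mul_add]
    by_cases hz : W z.1 z.2 = 0
    · rw [hz, zero_mul, zero_mul]
    · refine mul_le_mul_of_nonneg_left ?_ (hW0 _ _)
      refine le_trans (le_of_eq ?_) (supMean_add_le (B := B) (fun i j => ?_) (fun i j => ?_))
      · simp only [hD]
        congr 1
        funext i j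
        rw [hsign z hz j]
        push_cast
        ring
      · rw [abs_sign_mul, abs_sign_mul]
        exact hg _ _
      · rw [abs_sign_mul, abs_sign_mul]
        exact hg _ _
  have hcard : ((2 : ℝ) ^ n)⁻¹ * ∑ _σ : Fin n → ℤˣ, (1 : ℝ) = 1 := by
    rw [Finset.sum_const, Finset.card_univ, Fintype.card_fun, Fintype.card_units_int,
      Fintype.card_fin]
    simp
  have hswap : ∀ τ : E → ℤˣ, ((2 : ℝ) ^ n)⁻¹ * ∑ σ : Fin n → ℤˣ, pexp p (fun X : Fin n → E =>
        supMean fun i j => ((σ j : ℤ) : ℝ) * (((τ (X j) : ℤ) : ℝ) * g i (X j))) =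
      pexp p (fun X : Fin n → E => ((2 : ℝ) ^ n)⁻¹ *
        ∑ σ : Fin n → ℤˣ, supMean fun i j => ((σ j : ℤ) : ℝ) * g i (X j)) := by
    intro τ
    rw [pexp_const_mul]
    congr 1
    unfold pexp
    rw [Finset.sum_comm]
    refine Finset.sum_congr rfl fun X _ => ?_
    rw [← Finset.mul_sum, sum_sign_supMean_mul (fun j => τ (X j)) fun i j => g i (X j)]
  calc _ ≤ ∑ z : (Fin n → E) × (Fin n → E), W z.1 z.2 * D 1 z := step1
    _ = ((2 : ℝ) ^ n)⁻¹ * ∑ σ : Fin n → ℤˣ,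
          ∑ z : (Fin n → E) × (Fin n → E), W z.1 z.2 * D σ z := by
        rw [← Finset.sum_congr rfl fun σ _ => step2 σ]
        nth_rewrite 1 [← one_mul (∑ z : (Fin n → E) × (Fin n → E), W z.1 z.2 * D 1 z)]
        nth_rewrite 1 [← hcard]
        rw [mul_assoc, Finset.sum_mul]
        simp only [one_mul]
    _ ≤ ((2 : ℝ) ^ n)⁻¹ * ∑ σ : Fin n → ℤˣ, (pexp p (fun X => supMean fun i j =>
            ((σ j : ℤ) : ℝ) * (((s (X j) : ℤ) : ℝ) * g i (X j))) +
          pexp p (fun X => supMean fun i j =>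
            ((σ j : ℤ) : ℝ) * (((-s (X j) : ℤˣ) : ℤ) * g i (X j)))) :=
        mul_le_mul_of_nonneg_left (Finset.sum_le_sum fun σ _ => step3 σ) (by positivity)
    _ = _ := by
        rw [Finset.sum_add_distrib, mul_add, hswap s, hswap fun e => -s e]
        ring

end Symmetrization

/-! ### Deviations of conditional means over the cells of a partition -/

section CondMean

variable {E β ι : Type*} [Fintype E]

open Classical in
/-- The mass under the weights `p` of the cell `π = c`. -/
def cellMass (p : E → ℝ) (π : E → β) (c : β) : ℝ := ∑ e, if π e = c then p e else 0

open Classical in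
/-- The mean of `g` given the cell `π = c`; it is `0` if the cell has no mass. -/
def condMean (p : E → ℝ) (π : E → β) (g : E → ℝ) (c : β) : ℝ :=
  (cellMass p π c)⁻¹ * ∑ e, if π e = c then p e * g e else 0

theorem cellMass_nonneg {p : E → ℝ} (hp : ∀ e, 0 ≤ p e) (π : E → β) (c : β) :
    0 ≤ cellMass p π c :=
  Finset.sum_nonneg fun e _ => by split_ifs <;> simp [hp e]

theorem le_cellMass {p : E → ℝ} (hp : ∀ e, 0 ≤ p e) (π : E → β) (e : E) :
    p e ≤ cellMass p π (π e) := by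
  classical
  have h := Finset.single_le_sum (f := fun e' => if π e' = π e then p e' else 0)
    (fun e' _ => by split_ifs <;> simp [hp e']) (Finset.mem_univ e)
  simpa [cellMass] using h

theorem mul_inv_cellMass_mul {p : E → ℝ} (hp : ∀ e, 0 ≤ p e) (π : E → β) (e : E) :
    p e * (cellMass p π (π e))⁻¹ * cellMass p π (π e) = p e := by
  by_cases h : cellMass p π (π e) = 0
  · have : p e = 0 := le_antisymm (h ▸ le_cellMass hp π e) (hp e)
    simp [this]
  · field_simp

theorem abs_condMean_le {p : E → ℝ} (hp : ∀ e, 0 ≤ p e) (π : E → β) {g : E → ℝ} {B : ℝ}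
    (hB : 0 ≤ B) (hg : ∀ e, |g e| ≤ B) (c : β) : |condMean p π g c| ≤ B := by
  classical
  have hm := cellMass_nonneg hp π c
  unfold condMean
  rw [abs_mul, abs_inv, abs_of_nonneg hm]
  have h1 : |∑ e, if π e = c then p e * g e else 0| ≤ cellMass p π c * B := by
    refine (Finset.abs_sum_le_sum_abs _ _).trans ?_
    rw [cellMass, Finset.sum_mul]
    refine Finset.sum_le_sum fun e _ => ?_
    split_ifs
    · rw [abs_mul, abs_of_nonneg (hp e)]
      exact mul_le_mul_of_nonneg_left (hg e) (hp e)
    · simp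
  calc (cellMass p π c)⁻¹ * |∑ e, if π e = c then p e * g e else 0|
      ≤ (cellMass p π c)⁻¹ * (cellMass p π c * B) :=
        mul_le_mul_of_nonneg_left h1 (inv_nonneg.2 hm)
    _ ≤ B := by
        rw [← mul_assoc]
        exact mul_le_of_le_one_left hB inv_mul_le_one

theorem condMean_const {p : E → ℝ} (hp1 : ∑ e, p e = 1) (c : β) (g : E → ℝ) :
    condMean p (fun _ => c) g c = ∑ e, p e * g e := by
  simp [condMean, cellMass, hp1]

open Classical in
/-- The law of a pair that is conditionally independent given the cell of `π`, each component
having weights `p`. -/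
def cellJoint (p : E → ℝ) (π : E → β) (e e' : E) : ℝ :=
  if π e' = π e then p e * (cellMass p π (π e))⁻¹ * p e' else 0

theorem cellJoint_comm (p : E → ℝ) (π : E → β) (e e' : E) :
    cellJoint p π e e' = cellJoint p π e' e := by
  unfold cellJoint
  by_cases h : π e' = π e
  · rw [if_pos h, if_pos h.symm, h]
    ring
  · rw [if_neg h, if_neg (Ne.symm h)]

theorem sum_cellJoint {p : E → ℝ} (hp : ∀ e, 0 ≤ p e) (π : E → β) (e : E) :
    ∑ e', cellJoint p π e e' = p e := by
  classical
  refine Eq.trans ?_ (mul_inv_cellMass_mul hp π e)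
  nth_rewrite 2 [cellMass]
  rw [Finset.mul_sum]
  refine Finset.sum_congr rfl fun e' _ => ?_
  by_cases h : π e' = π e <;> simp [cellJoint, h]

theorem sum_cellJoint_mul (p : E → ℝ) (π : E → β) (g : E → ℝ) (e : E) :
    ∑ e', cellJoint p π e e' * g e' = p e * condMean p π g (π e) := by
  classical
  rw [condMean, ← mul_assoc, Finset.mul_sum]
  refine Finset.sum_congr rfl fun e' _ => ?_
  by_cases h : π e' = π e
  · simp only [cellJoint, h, if_true]
    ring
  · simp [cellJoint, h]

/-- For fixed signs `s` of the cells, the supremum over a class `g` of the signed mean deviation of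
`g` from its conditional means exceeds twice the Rademacher complexity with small probability:
symmetrization bounds its mean, and McDiarmid's inequality its fluctuations. -/
theorem pexp_deviation_le [Nonempty ι] {p : E → ℝ} (hp : ∀ e, 0 ≤ p e) (hp1 : ∑ e, p e = 1)
    {g : ι → E → ℝ} {B : ℝ} (hB : 0 < B) (hg : ∀ i e, |g i e| ≤ B) (π : E → β) (s : β → ℤˣ)
    {n : ℕ} (hn : 0 < n) {r : ℝ} (hr : 0 ≤ r) {P : (Fin n → E) → Prop} [DecidablePred P]
    (hP : ∀ X, P X → 2 * pexp p (fun X : Fin n → E => ((2 : ℝ) ^ n)⁻¹ *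
        ∑ σ : Fin n → ℤˣ, supMean fun i j => ((σ j : ℤ) : ℝ) * g i (X j)) + r <
      supMean fun i j => ((s (π (X j)) : ℤ) : ℝ) * (condMean p π (g i) (π (X j)) - g i (X j))) :
    pexp p (fun X => if P X then 1 else 0) ≤ Real.exp (-(n * r ^ 2 / (32 * B ^ 2))) := by
  classical
  have hn' : (0 : ℝ) < n := by exact_mod_cast hn
  set Φ : (Fin n → E) → ℝ := fun X =>
    supMean fun i j => ((s (π (X j)) : ℤ) : ℝ) * (condMean p π (g i) (π (X j)) - g i (X j))
    with hΦ
  have hmean := symmetrization (n := n) (p := p) (Q := cellJoint p π) (g := g)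
    (gbar := fun i e => condMean p π (g i) (π e))
    (fun e e' => by
      unfold cellJoint
      split_ifs
      · exact mul_nonneg (mul_nonneg (hp e) (inv_nonneg.2 (cellMass_nonneg hp π _))) (hp e')
      · exact le_rfl)
    (cellJoint_comm p π) (sum_cellJoint hp π) hg (fun i e => sum_cellJoint_mul p π (g i) e)
    (fun e => s (π e)) (fun e e' h => by
      by_cases h' : π e' = π e
      · rw [h']
      · exact absurd (by simp [cellJoint, h']) h)
  have hterm : ∀ i e, |((s (π e) : ℤ) : ℝ) * (condMean p π (g i) (π e) - g i e)| ≤ 2 * B := by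
    intro i e
    rw [abs_sign_mul]
    refine (abs_sub _ _).trans ?_
    linarith [abs_condMean_le hp π hB.le (hg i) (π e), hg i e]
  have hbd : ∀ X i e, |Φ (Function.update X i e) - Φ X| ≤ (n : ℝ)⁻¹ * (4 * B) := by
    intro X k e
    refine abs_supMean_sub_le (B := 2 * B) (fun i j => hterm i _) (fun i j => hterm i _) k
      (fun i j hj => by simp only [Function.update_of_ne hj]) fun i => ?_
    refine (abs_sub _ _).trans ?_
    linarith [hterm i (Function.update X k e k), hterm i (X k)]
  have hmc := pexp_mcdiarmid hp hp1 (c := (n : ℝ)⁻¹ * (4 * B)) (by positivity) hn Φ hbd hr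
  have hexp : r ^ 2 / (2 * n * ((n : ℝ)⁻¹ * (4 * B)) ^ 2) = n * r ^ 2 / (32 * B ^ 2) := by
    field_simp
    ring
  rw [hexp] at hmc
  refine le_trans (pexp_mono hp fun X => ?_) hmc
  by_cases h : P X
  · have h2 : pexp p Φ + r < Φ X := lt_of_le_of_lt (by linarith) (hP X h)
    rw [if_pos h, if_pos h2]
  · rw [if_neg h]
    split_ifs <;> norm_num

end CondMean

open Classical in
/-- The mean of `y` over the indices in the cell `b = c`. -/
def cellAverage {β : Type*} {n : ℕ} (b : Fin n → β) (y : Fin n → ℝ) (c : β) : ℝ :=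
  ((Finset.univ.filter fun k => b k = c).card : ℝ)⁻¹ *
    ∑ k ∈ Finset.univ.filter (fun k => b k = c), y k

/-- Replacing the terms by their averages over the cells does not change the sum of the terms
weighted by a function of the cell. -/
theorem sum_mul_cellAverage {β : Type*} {n : ℕ} (b : Fin n → β) (y : Fin n → ℝ) (w : β → ℝ) :
    ∑ j, w (b j) * cellAverage b y (b j) = ∑ j, w (b j) * y j := by
  classical
  have h1 : ∀ j, w (b j) * cellAverage b y (b j) = ∑ k, if b k = b j then
      w (b k) * ((Finset.univ.filter fun i => b i = b k).card : ℝ)⁻¹ * y k else 0 := by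
    intro j
    rw [cellAverage, ← mul_assoc, Finset.sum_filter, Finset.mul_sum]
    refine Finset.sum_congr rfl fun k _ => ?_
    by_cases h : b k = b j <;> simp [h]
  rw [Finset.sum_congr rfl fun j _ => h1 j, Finset.sum_comm]
  refine Finset.sum_congr rfl fun k _ => ?_
  have hpos : ((Finset.univ.filter fun i => b i = b k).card : ℝ) ≠ 0 := by
    have : k ∈ Finset.univ.filter fun i => b i = b k := by simp
    exact_mod_cast (Finset.card_pos.2 ⟨k, this⟩).ne'
  have h2 : (Finset.univ.filter fun j => b k = b j) = Finset.univ.filter fun j => b j = b k :=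
    Finset.filter_congr fun j _ => eq_comm
  rw [← Finset.sum_filter, Finset.sum_const, h2, nsmul_eq_mul]
  field_simp

/-- The total deviation of cell averages is attained by signs of the cells, and with signs that
depend on the cell only, each average may be replaced by the terms that it averages. -/
theorem exists_signs_sum_abs {β : Type*} {n : ℕ} (b : Fin n → β) (y : Fin n → ℝ) (κ : β → ℝ) :
    ∃ s : β → ℤˣ, ∑ j, |κ (b j) - cellAverage b y (b j)| =
      ∑ j, ((s (b j) : ℤ) : ℝ) * (κ (b j) - y j) := by
  classical
  refine ⟨fun c => if 0 ≤ κ c - cellAverage b y c then 1 else -1, ?_⟩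
  simp only [mul_sub, Finset.sum_sub_distrib]
  rw [← sum_mul_cellAverage b y fun c =>
    (((if 0 ≤ κ c - cellAverage b y c then 1 else -1 : ℤˣ) : ℤ) : ℝ), ← Finset.sum_sub_distrib]
  refine Finset.sum_congr rfl fun j _ => ?_
  rw [← mul_sub]
  split_ifs with h
  · simp [abs_of_nonneg h]
  · rw [abs_of_neg (not_le.1 h)]
    simp

/-! ### Samples seen through a finite encoding -/

section Encoding

variable {Ω E : Type*} [MeasurableSpace Ω] [MeasurableSpace E]

/-- The weights on the finite set `E` of the code of a point with law `μ`. -/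
def codeWeight (μ : Measure Ω) (enc : Ω → E) (e : E) : ℝ := (μ.map enc).real {e}

theorem codeWeight_nonneg (μ : Measure Ω) (enc : Ω → E) (e : E) : 0 ≤ codeWeight μ enc e :=
  measureReal_nonneg

variable [Fintype E] [MeasurableSingletonClass E]

theorem integral_code (μ : Measure Ω) [IsProbabilityMeasure μ] {enc : Ω → E}
    (henc : Measurable enc) (Φ : E → ℝ) :
    ∫ x, Φ (enc x) ∂μ = ∑ e, codeWeight μ enc e * Φ e := by
  have : IsProbabilityMeasure (μ.map enc) := Measure.isProbabilityMeasure_map henc.aemeasurable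
  rw [← integral_map henc.aemeasurable (measurable_of_finite Φ).aestronglyMeasurable,
    integral_fintype Integrable.of_finite]
  rfl

theorem sum_codeWeight (μ : Measure Ω) [IsProbabilityMeasure μ] {enc : Ω → E}
    (henc : Measurable enc) : ∑ e, codeWeight μ enc e = 1 := by
  simpa using (integral_code μ henc fun _ => 1).symm

theorem measurableSet_code_cell {β : Type*} {enc : Ω → E} (henc : Measurable enc) (π : E → β)
    (c : β) : MeasurableSet {x | π (enc x) = c} :=
  henc (Set.toFinite {e | π e = c}).measurableSet

/-- The conditional mean of the code weights is the normalized integral over the cell. -/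
theorem condMean_codeWeight {β : Type*} (μ : Measure Ω) [IsProbabilityMeasure μ] {enc : Ω → E}
    (henc : Measurable enc) (π : E → β) (Φ : E → ℝ) (c : β) :
    condMean (codeWeight μ enc) π Φ c =
      (μ.real {x | π (enc x) = c})⁻¹ * ∫ x in {x | π (enc x) = c}, Φ (enc x) ∂μ := by
  classical
  have hset : ∀ Ψ : E → ℝ, ∫ x in {x | π (enc x) = c}, Ψ (enc x) ∂μ =
      ∑ e, if π e = c then codeWeight μ enc e * Ψ e else 0 := by
    intro Ψ
    have h := integral_code μ henc fun e => if π e = c then Ψ e else 0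
    simp only [mul_ite, mul_zero] at h
    rw [← h, ← integral_indicator (measurableSet_code_cell henc π c)]
    refine integral_congr_ae (Filter.Eventually.of_forall fun x => ?_)
    simp only [Set.indicator_apply, Set.mem_ofPred_eq]
  have hmass : μ.real {x | π (enc x) = c} = cellMass (codeWeight μ enc) π c := by
    simpa [cellMass] using hset fun _ => 1
  rw [hset, hmass, condMean]

theorem integral_pi_code (μ : Measure Ω) [IsProbabilityMeasure μ] {enc : Ω → E}
    (henc : Measurable enc) {n : ℕ} (Φ : (Fin n → E) → ℝ) :
    ∫ X, Φ (fun j => enc (X j)) ∂(Measure.pi fun _ : Fin n => μ) =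
      pexp (codeWeight μ enc) Φ := by
  have : IsProbabilityMeasure (μ.map enc) := Measure.isProbabilityMeasure_map henc.aemeasurable
  have hmeas : Measurable fun (X : Fin n → Ω) j => enc (X j) :=
    measurable_pi_lambda _ fun j => henc.comp (measurable_pi_apply j)
  rw [← integral_map (φ := fun (X : Fin n → Ω) j => enc (X j)) hmeas.aemeasurable
      (measurable_of_finite Φ).aestronglyMeasurable,
    Measure.pi_map_pi fun _ => henc.aemeasurable, integral_fintype Integrable.of_finite]
  refine Finset.sum_congr rfl fun X _ => ?_
  rw [smul_eq_mul, measureReal_def, Measure.pi_singleton, ENNReal.toReal_prod]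
  rfl

theorem measureReal_pi_code (μ : Measure Ω) [IsProbabilityMeasure μ] {enc : Ω → E}
    (henc : Measurable enc) {n : ℕ} (P : (Fin n → E) → Prop) [DecidablePred P] :
    (Measure.pi fun _ : Fin n => μ).real {X | P fun j => enc (X j)} =
      pexp (codeWeight μ enc) (fun X => if P X then 1 else 0) := by
  have hmeas : Measurable fun (X : Fin n → Ω) j => enc (X j) :=
    measurable_pi_lambda _ fun j => henc.comp (measurable_pi_apply j)
  have hset : MeasurableSet {X : Fin n → Ω | P fun j => enc (X j)} :=
    hmeas (Set.toFinite {X | P X}).measurableSet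
  rw [← integral_pi_code μ henc, ← integral_indicator_one hset]
  refine integral_congr_ae (Filter.Eventually.of_forall fun X => ?_)
  simp [Set.indicator_apply]

theorem measurableSet_pi_code {enc : Ω → E} (henc : Measurable enc) {n : ℕ}
    (P : (Fin n → E) → Prop) : MeasurableSet {X : Fin n → Ω | P fun j => enc (X j)} :=
  (measurable_pi_lambda _ fun j => henc.comp (measurable_pi_apply j) :
    Measurable fun (X : Fin n → Ω) j => enc (X j)) (Set.toFinite {X | P X}).measurableSet

theorem rademacher_eq_pexp (μ : Measure Ω) [IsProbabilityMeasure μ] {enc : Ω → E}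
    (henc : Measurable enc) (dec : E → Ω) {G : Set (Ω → ℝ)}
    (hG : ∀ u ∈ G, ∀ x, u (dec (enc x)) = u x) (n : ℕ) :
    rademacher μ G n = pexp (codeWeight μ enc) (fun X : Fin n → E => ((2 : ℝ) ^ n)⁻¹ *
      ∑ σ : Fin n → ℤˣ, supMean fun (u : G) j => ((σ j : ℤ) : ℝ) * u.1 (dec (X j))) := by
  rw [← integral_pi_code μ henc, rademacher]
  congr 1
  funext X
  simp only [empiricalRademacher, supMean]
  simp only [fun (u : G) x => hG u.1 u.2 x]

/-- The deviation event of a class `G` for the partition `π` of the codes and the signs `s` of its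
cells, at confidence `exp (-L)`. -/
def deviationEvent {β : Type*} (μ : Measure Ω) (enc : Ω → E) (dec : E → Ω) (G : Set (Ω → ℝ))
    (B L : ℝ) (π : E → β) (s : β → ℤˣ) (n : ℕ) : Set (Fin n → Ω) :=
  {X | 2 * rademacher μ G n + B * Real.sqrt (32 * L / n) <
    supMean fun (u : G) j => ((s (π (enc (X j))) : ℤ) : ℝ) *
      (condMean (codeWeight μ enc) π (fun e => u.1 (dec e)) (π (enc (X j))) -
        u.1 (dec (enc (X j))))}

theorem measurableSet_deviationEvent {β : Type*} (μ : Measure Ω) {enc : Ω → E}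
    (henc : Measurable enc) (dec : E → Ω) (G : Set (Ω → ℝ)) (B L : ℝ) (π : E → β) (s : β → ℤˣ)
    (n : ℕ) : MeasurableSet (deviationEvent μ enc dec G B L π s n) :=
  measurableSet_pi_code henc fun Y => 2 * rademacher μ G n + B * Real.sqrt (32 * L / n) <
    supMean fun (u : G) j => ((s (π (Y j)) : ℤ) : ℝ) *
      (condMean (codeWeight μ enc) π (fun e => u.1 (dec e)) (π (Y j)) - u.1 (dec (Y j)))

theorem measureReal_deviationEvent_le {β : Type*} (μ : Measure Ω) [IsProbabilityMeasure μ]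
    {enc : Ω → E} (henc : Measurable enc) (dec : E → Ω) {G : Set (Ω → ℝ)}
    (hG : ∀ u ∈ G, ∀ x, u (dec (enc x)) = u x) {B : ℝ} (hB : 0 < B)
    (hGB : ∀ u ∈ G, ∀ x, |u x| ≤ B) {L : ℝ} (hL : 0 ≤ L) (π : E → β) (s : β → ℤˣ)
    {n : ℕ} (hn : 0 < n) :
    (Measure.pi fun _ : Fin n => μ).real (deviationEvent μ enc dec G B L π s n) ≤
      Real.exp (-L) := by
  classical
  have hn' : (0 : ℝ) < n := by exact_mod_cast hn
  rcases G.eq_empty_or_nonempty with rfl | hne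
  · have h0 : deviationEvent μ enc dec (∅ : Set (Ω → ℝ)) B L π s n = ∅ := by
      refine Set.eq_empty_of_forall_notMem fun X hX => ?_
      have h1 : rademacher μ (∅ : Set (Ω → ℝ)) n = 0 := by
        simp [rademacher, empiricalRademacher]
      have h2 : 0 ≤ B * Real.sqrt (32 * L / n) := by positivity
      simp only [deviationEvent, h1, Set.mem_ofPred_eq, supMean, Real.iSup_of_isEmpty] at hX
      linarith
    rw [h0, measureReal_empty]
    exact (Real.exp_pos _).le
  · have : Nonempty G := hne.to_subtype
    set r := B * Real.sqrt (32 * L / n) with hr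
    have hexp : n * r ^ 2 / (32 * B ^ 2) = L := by
      rw [hr, mul_pow, Real.sq_sqrt (by positivity)]
      field_simp
    rw [show -L = -(n * r ^ 2 / (32 * B ^ 2)) by rw [hexp]]
    refine (measureReal_pi_code μ henc fun Y => 2 * rademacher μ G n + B * Real.sqrt (32 * L / n) <
      supMean fun (u : G) j => ((s (π (Y j)) : ℤ) : ℝ) *
        (condMean (codeWeight μ enc) π (fun e => u.1 (dec e)) (π (Y j)) - u.1 (dec (Y j)))).trans_le ?_
    refine pexp_deviation_le (codeWeight_nonneg μ enc) (sum_codeWeight μ henc) hB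
      (g := fun (u : G) e => u.1 (dec e)) (fun u e => hGB u.1 u.2 _) π s hn (by positivity)
      fun X hX => ?_
    rw [← rademacher_eq_pexp μ henc dec hG]
    exact hX

end Encoding

/-! ### The grid encoding of paths -/

section Encode

variable {a b : ℝ} {d T M : ℕ}

/-- The index of the grid interval that contains `u`. -/
def gridIndex (a b : ℝ) (hM : 0 < M) (u : ℝ) : Fin M :=
  ⟨min ⌊(M : ℝ) * (u - a) / (b - a)⌋₊ (M - 1), by
    have := min_le_right ⌊(M : ℝ) * (u - a) / (b - a)⌋₊ (M - 1)
    omega⟩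

/-- The centre of the grid interval with index `k`. -/
def gridPoint (a b : ℝ) (k : Fin M) : ℝ := a + ((k.val : ℝ) + 1 / 2) * ((b - a) / (M : ℝ))

theorem gridPoint_gridIndex (hM : 0 < M) (u : ℝ) :
    gridPoint a b (gridIndex a b hM u) = gridCenter a b M u := rfl

theorem gridIndex_gridPoint (hab : a < b) (hM : 0 < M) (k : Fin M) :
    gridIndex a b hM (gridPoint a b k) = k := by
  have hM' : (0 : ℝ) < M := by exact_mod_cast hM
  have hba : b - a ≠ 0 := by linarith [hab]
  have h1 : (M : ℝ) * (gridPoint a b k - a) / (b - a) = (k.val : ℝ) + 1 / 2 := by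
    unfold gridPoint
    field_simp
    ring
  have h2 : ⌊(k.val : ℝ) + 1 / 2⌋₊ = k.val := by
    rw [Nat.floor_eq_iff (by positivity)]
    constructor <;> linarith
  refine Fin.ext ?_
  simp only [gridIndex, h1, h2]
  exact min_eq_left (by have := k.isLt; omega)

theorem gridPoint_mem (hab : a < b) (hM : 0 < M) (k : Fin M) :
    a ≤ gridPoint a b k ∧ gridPoint a b k ≤ b := by
  have h := gridCenter_mem hab.le M (gridPoint a b k)
  rwa [← gridPoint_gridIndex hM, gridIndex_gridPoint hab] at h

/-- The grid cells that a path visits. -/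
def encodePath (hM : 0 < M) (x : Path a b d T) : Fin T → Fin d → Fin M :=
  fun s i => gridIndex a b hM ((x s).1 i)

/-- The path through the centres of given grid cells. -/
def decodePath (hab : a < b) (hM : 0 < M) (e : Fin T → Fin d → Fin M) : Path a b d T :=
  fun s => ⟨fun i => gridPoint a b (e s i), fun i => (gridPoint_mem hab hM (e s i)).1,
    fun i => (gridPoint_mem hab hM (e s i)).2⟩

theorem encodePath_decodePath (hab : a < b) (hM : 0 < M) (e : Fin T → Fin d → Fin M) :
    encodePath hM (decodePath hab hM e) = e := by
  funext s i
  exact gridIndex_gridPoint hab hM _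

theorem measurable_gridIndex (hM : 0 < M) : Measurable (gridIndex a b hM) := by
  refine measurable_to_countable' fun k => ?_
  have h : gridIndex a b hM ⁻¹' {k} =
      (fun u : ℝ => min ⌊(M : ℝ) * (u - a) / (b - a)⌋₊ (M - 1)) ⁻¹' {k.val} := by
    ext u
    simp [gridIndex, Fin.ext_iff]
  rw [h]
  have hm : Measurable fun u : ℝ => min ⌊(M : ℝ) * (u - a) / (b - a)⌋₊ (M - 1) := by
    refine Measurable.min (Nat.measurable_floor.comp ?_) measurable_const
    fun_prop
  exact hm (measurableSet_singleton _)

theorem measurable_encodePath (hM : 0 < M) :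
    Measurable (encodePath hM : Path a b d T → Fin T → Fin d → Fin M) := by
  refine measurable_pi_lambda _ fun s => measurable_pi_lambda _ fun i => ?_
  exact (measurable_gridIndex hM).comp
    ((measurable_pi_apply i).comp (measurable_subtype_coe.comp (measurable_pi_apply s)))

theorem quant_eq (hab : a < b) {N : ℕ} (hM : 0 < cellsPerAxis d T N) (x : Path a b d T) :
    quant N x = decodePath hab hM (encodePath hM x) := rfl

theorem encodePath_quant (hab : a < b) {N : ℕ} (hM : 0 < cellsPerAxis d T N)
    (x : Path a b d T) : encodePath hM (quant N x) = encodePath hM x := by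
  rw [quant_eq hab, encodePath_decodePath]

theorem quant_quant (hab : a < b) {N : ℕ} (hM : 0 < cellsPerAxis d T N) (x : Path a b d T) :
    quant N (quant N x) = quant N x := by
  rw [quant_eq hab hM (quant N x), encodePath_quant hab, ← quant_eq hab]

theorem quantPoint_eq_iff (hab : a < b) (hM : 0 < M) (x z : Path a b d T) (s : Fin T) :
    quantPoint M (z s) = quantPoint M (x s) ↔ encodePath hM z s = encodePath hM x s := by
  constructor
  · intro h
    funext i
    have h1 := congrFun (congrArg Subtype.val h) i
    have h2 := congrArg (gridIndex a b hM) h1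
    simp only [quantPoint, ← gridPoint_gridIndex hM] at h2
    rwa [gridIndex_gridPoint hab, gridIndex_gridPoint hab] at h2
  · intro h
    refine Subtype.ext (funext fun i => ?_)
    simp only [quantPoint, ← gridPoint_gridIndex hM]
    exact congrArg _ (congrFun h i)

/-- The grid cells up to time `t + 1`, later cells being replaced by a fixed one. In this way the
prefixes of all lengths below `T` live in one type, of size `M ^ (d (T - 1))`. -/
def codePrefix (hM : 0 < M) (t : Fin (T - 1)) (e : Fin T → Fin d → Fin M) :
    Fin (T - 1) → Fin d → Fin M :=
  fun s => if s ≤ t then e ⟨s.val, by have := s.isLt; omega⟩ else fun _ => ⟨0, hM⟩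

theorem codePrefix_eq_iff (hM : 0 < M) (t : Fin (T - 1)) (e e' : Fin T → Fin d → Fin M) :
    codePrefix hM t e = codePrefix hM t e' ↔ ∀ s : Fin T, s.val < t.val + 1 → e s = e' s := by
  constructor
  · intro h s hs
    have hsT : s.val < T - 1 := by have := t.isLt; omega
    have h1 := congrFun h ⟨s.val, hsT⟩
    have h2 : (⟨s.val, hsT⟩ : Fin (T - 1)) ≤ t := Fin.mk_le_of_le_val (by omega)
    simpa only [codePrefix, if_pos h2] using h1
  · intro h
    funext s
    by_cases hs : s ≤ t
    · simp only [codePrefix, if_pos hs]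
      exact h _ (Nat.lt_succ_of_le hs)
    · simp only [codePrefix, if_neg hs]

theorem mem_cell_iff (hab : a < b) {N : ℕ} (hM : 0 < cellsPerAxis d T N) (t : Fin (T - 1))
    (x z : Path a b d T) : z ∈ cell N (t.val + 1) x ↔
      codePrefix hM t (encodePath hM z) = codePrefix hM t (encodePath hM x) := by
  rw [codePrefix_eq_iff]
  exact forall_congr' fun s => imp_congr_right fun _ => quantPoint_eq_iff hab hM x z s

theorem quant_splice {N : ℕ} {t : ℕ} {x z : Path a b d T} (hz : z ∈ cell N t x) :
    quant N (splice t x z) = quant N z := by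
  funext s
  by_cases hs : s.val < t
  · simp only [quant, splice, if_pos hs]
    exact (hz s hs).symm
  · simp only [quant, splice, if_neg hs]

theorem splice_quant {N : ℕ} {t : ℕ} {x z : Path a b d T} (hz : z ∈ cell N t x) :
    splice t (quant N x) (quant N z) = quant N z := by
  funext s
  by_cases hs : s.val < t
  · simp only [quant, splice, if_pos hs]
    exact (hz s hs).symm
  · simp only [splice, if_neg hs]

/-- The conditional expectation that enters `quantF` is a conditional mean of the encoded path. -/
theorem integral_cond_cell_eq (hab : a < b) (μ : Measure (Path a b d T)) [IsProbabilityMeasure μ]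
    {N : ℕ} (hM : 0 < cellsPerAxis d T N) (t : Fin (T - 1)) (g : Path a b d T → ℝ)
    (x : Path a b d T) :
    ∫ z, g (quant N (splice (t.val + 1) x z)) ∂(ProbabilityTheory.cond μ (cell N (t.val + 1) x)) =
      condMean (codeWeight μ (encodePath hM)) (codePrefix hM t) (fun e => g (decodePath hab hM e))
        (codePrefix hM t (encodePath hM x)) := by
  have henc := measurable_encodePath (a := a) (b := b) (d := d) (T := T) hM
  have hcell : cell N (t.val + 1) x = {z | codePrefix hM t (encodePath hM z) =
      codePrefix hM t (encodePath hM x)} := Set.ext fun z => mem_cell_iff hab hM t x z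
  have hmeas : MeasurableSet (cell N (t.val + 1) x) := by
    rw [hcell]
    exact measurableSet_code_cell henc _ _
  rw [condMean_codeWeight μ henc, ← hcell, ProbabilityTheory.cond, integral_smul_measure,
    ENNReal.toReal_inv, ← measureReal_def, smul_eq_mul]
  congr 1
  refine setIntegral_congr_fun hmeas fun z hz => ?_
  rw [quant_splice hz, quant_eq hab hM]

theorem integral_adaptedConditional {β : Type*} {N : ℕ} (X : Fin N → Path a b d T)
    {A : Set (Path a b d T)} {b' : Fin N → β} {c : β} (hA : ∀ k, X k ∈ A ↔ b' k = c)
    (Φ : Path a b d T → ℝ) :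
    ∫ z, Φ z ∂(adaptedConditional N X A) = cellAverage b' (fun k => Φ (quant N (X k))) c := by
  rw [adaptedConditional, integral_smul_measure,
    integral_finsetSum_measure fun k _ => integrable_dirac (by simp),
    ENNReal.toReal_inv, ENNReal.toReal_natCast, smul_eq_mul, cellAverage]
  simp only [integral_dirac]
  classical
  rw [Finset.filter_congr fun k _ => hA k]

theorem cellAverage_congr {β : Type*} {n : ℕ} {b' : Fin n → β} {y y' : Fin n → ℝ} {c : β}
    (h : ∀ k, b' k = c → y k = y' k) : cellAverage b' y c = cellAverage b' y' c := by
  classical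
  unfold cellAverage
  congr 1
  exact Finset.sum_congr rfl fun k hk => h k (Finset.mem_filter.1 hk).2

/-- The empirical conditional expectation is an average over the sample points in a cell. -/
theorem integral_adaptedConditional_cell (hab : a < b) {N : ℕ} (hM : 0 < cellsPerAxis d T N)
    (t : Fin (T - 1)) (g : Path a b d T → ℝ) (X : Fin N → Path a b d T) (n : Fin N) :
    ∫ z, g (splice (t.val + 1) (quant N (X n)) z)
        ∂(adaptedConditional N X (cell N (t.val + 1) (quant N (X n)))) =
      cellAverage (fun k => codePrefix hM t (encodePath hM (X k))) (fun k => g (quant N (X k)))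
        (codePrefix hM t (encodePath hM (X n))) := by
  have hmem : ∀ k, X k ∈ cell N (t.val + 1) (quant N (X n)) ↔
      codePrefix hM t (encodePath hM (X k)) = codePrefix hM t (encodePath hM (X n)) := by
    intro k
    rw [mem_cell_iff hab hM, encodePath_quant hab]
  rw [integral_adaptedConditional X hmem fun z => g (splice (t.val + 1) (quant N (X n)) z)]
  refine cellAverage_congr fun k hk => ?_
  rw [splice_quant ((mem_cell_iff hab hM t _ _).2 hk)]

theorem integral_adaptedEmpirical {N : ℕ} (X : Fin N → Path a b d T) (Φ : Path a b d T → ℝ) :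
    ∫ x, Φ x ∂(adaptedEmpirical N X) = (N : ℝ)⁻¹ * ∑ n, Φ (quant N (X n)) := by
  rw [adaptedEmpirical, integral_smul_measure,
    integral_finsetSum_measure fun k _ => integrable_dirac (by simp),
    ENNReal.toReal_inv, ENNReal.toReal_natCast, smul_eq_mul]
  simp only [integral_dirac]

end Encode

/-! ### Consequences of avoiding the deviation events -/

section Good

variable {Ω E : Type*} [MeasurableSpace Ω] [MeasurableSpace E] [Fintype E]

/-- Outside the deviation events of all choices of signs for the cells, the mean absolute deviation
of the cell averages from the conditional means is controlled uniformly over the class. -/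
theorem mean_abs_sub_cellAverage_le {β : Type*} (μ : Measure Ω)
    {enc : Ω → E} {dec : E → Ω} {G : Set (Ω → ℝ)}
    (hG : ∀ u ∈ G, ∀ x, u (dec (enc x)) = u x) {B L : ℝ} (hB : 0 ≤ B)
    (hGB : ∀ u ∈ G, ∀ x, |u x| ≤ B) {π : E → β} {n : ℕ} {X : Fin n → Ω}
    (hX : ∀ s, X ∉ deviationEvent μ enc dec G B L π s n) {u : Ω → ℝ} (hu : u ∈ G) :
    (n : ℝ)⁻¹ * ∑ j, |condMean (codeWeight μ enc) π (fun e => u (dec e)) (π (enc (X j))) -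
        cellAverage (fun k => π (enc (X k))) (fun k => u (X k)) (π (enc (X j)))| ≤
      2 * rademacher μ G n + B * Real.sqrt (32 * L / n) := by
  obtain ⟨s, hs⟩ := exists_signs_sum_abs (fun k => π (enc (X k))) (fun k => u (X k))
    (condMean (codeWeight μ enc) π fun e => u (dec e))
  rw [hs]
  have h1 := hX s
  simp only [deviationEvent, Set.mem_ofPred_eq, not_lt] at h1
  refine le_trans ?_ h1
  have h2 := mean_le_supMean (B := 2 * B) (w := fun (u : G) j => ((s (π (enc (X j))) : ℤ) : ℝ) *
      (condMean (codeWeight μ enc) π (fun e => u.1 (dec e)) (π (enc (X j))) -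
        u.1 (dec (enc (X j))))) (fun v j => by
    rw [abs_sign_mul]
    refine (abs_sub _ _).trans ?_
    have h3 := abs_condMean_le (codeWeight_nonneg μ enc) π hB
      (g := fun e => v.1 (dec e)) (fun e => hGB v.1 v.2 _) (π (enc (X j)))
    linarith [hGB v.1 v.2 (dec (enc (X j)))]) ⟨u, hu⟩
  simpa only [hG u hu] using h2

theorem abs_integral_sub_mean_le [MeasurableSingletonClass E] (μ : Measure Ω) [IsProbabilityMeasure μ]
    {enc : Ω → E} (henc : Measurable enc) {dec : E → Ω} {G : Set (Ω → ℝ)}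
    (hG : ∀ u ∈ G, ∀ x, u (dec (enc x)) = u x) {B L : ℝ} (hB : 0 ≤ B)
    (hGB : ∀ u ∈ G, ∀ x, |u x| ≤ B) {n : ℕ} (hn : 0 < n) {X : Fin n → Ω}
    (hX : ∀ s, X ∉ deviationEvent μ enc dec G B L (fun _ => ()) s n) {u : Ω → ℝ} (hu : u ∈ G) :
    |∫ x, u x ∂μ - (n : ℝ)⁻¹ * ∑ j, u (X j)| ≤
      2 * rademacher μ G n + B * Real.sqrt (32 * L / n) := by
  have hn' : (n : ℝ) ≠ 0 := by exact_mod_cast hn.ne'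
  have h := mean_abs_sub_cellAverage_le μ hG hB hGB hX hu
  have hint : ∫ x, u x ∂μ = ∑ e, codeWeight μ enc e * u (dec e) := by
    rw [← integral_code μ henc fun e => u (dec e)]
    simp only [hG u hu]
  rw [condMean_const (sum_codeWeight μ henc), ← hint] at h
  have havg : cellAverage (fun _ : Fin n => ()) (fun k => u (X k)) () =
      (n : ℝ)⁻¹ * ∑ j, u (X j) := by
    simp [cellAverage]
  rw [havg, Finset.sum_const, Finset.card_univ, Fintype.card_fin, nsmul_eq_mul, ← mul_assoc,
    inv_mul_cancel₀ hn', one_mul] at h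
  exact h

end Good

/-! ### The dual objective -/

section Dual

variable {a b : ℝ} {d T : ℕ}

theorem exists_bound_h (H : HypothesisSet a b d T) :
    ∃ K : ℝ, 0 < K ∧ ∀ l t, ∀ θ ∈ H.C, ∀ y, |H.h l t θ y| ≤ K := by
  have h1 : ∀ p : Fin H.L × Fin (T - 1), ∃ K : ℝ, ∀ θ ∈ H.C, ∀ y, |H.h p.1 p.2 θ y| ≤ K := by
    intro p
    obtain ⟨K, hK⟩ := (H.isCompact_C.prod isCompact_univ).exists_bound_of_continuousOn
      (H.continuousOn_h p.1 p.2)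
    exact ⟨K, fun θ hθ y => by simpa using hK (θ, y) ⟨hθ, Set.mem_univ y⟩⟩
  choose K hK using h1
  refine ⟨1 + ∑ p, |K p|, by positivity, fun l t θ hθ y => ?_⟩
  have h2 := Finset.single_le_sum (f := fun p => |K p|) (fun p _ => abs_nonneg _)
    (Finset.mem_univ (l, t))
  have h3 := hK (l, t) θ hθ y
  have h4 := le_abs_self (K (l, t))
  dsimp only at h2 h3
  linarith

theorem exists_bound_of_continuous {Z : Type*} [TopologicalSpace Z] [CompactSpace Z]
    {f : Z → ℝ} (hf : Continuous f) : ∃ K : ℝ, 0 < K ∧ ∀ x, |f x| ≤ K := by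
  obtain ⟨K, hK⟩ := isCompact_univ.exists_bound_of_continuousOn hf.continuousOn
  exact ⟨max K 1, by positivity, fun x =>
    (by simpa using hK x (Set.mem_univ x) : |f x| ≤ K).trans (le_max_left _ _)⟩

theorem nonempty_path (hab : a < b) : Nonempty (Path a b d T) :=
  ⟨fun _ => ⟨fun _ => a, ⟨fun _ => le_rfl, fun _ => hab.le⟩⟩⟩

section InnerSup

variable {f : Path a b d T → ℝ} {c : Path a b d T → Path a b d T → ℝ}
  {H : HypothesisSet a b d T} {Bf Bc K : ℝ}

theorem abs_dual_integrand_le (hf : ∀ y, |f y| ≤ Bf) (hc : ∀ x y, |c x y| ≤ Bc)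
    (hK : ∀ l t, ∀ θ ∈ H.C, ∀ y, |H.h l t θ y| ≤ K)
    {θ : (Fin H.m → ℝ) × (Fin H.m → ℝ) × ℝ} (hθ : θ ∈ H.params) (x : Path a b d T)
    (κ : Fin H.L → Fin (T - 1) → ℝ) (y : Path a b d T) :
    |f y - θ.2.2 * c x y + ∑ l, ∑ t, H.h l t θ.2.1 (initSeg t y) * (H.g l t θ.1 x - κ l t)| ≤
      Bf + H.lamMax * Bc + ∑ l, ∑ t, K * |H.g l t θ.1 x - κ l t| := by
  obtain ⟨-, hθ2, hθ3⟩ := hθ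
  have h1 : |θ.2.2 * c x y| ≤ H.lamMax * Bc := by
    rw [abs_mul, abs_of_nonneg hθ3.1]
    exact mul_le_mul hθ3.2 (hc x y) (abs_nonneg _) H.lamMax_nonneg
  have h2 : |∑ l, ∑ t, H.h l t θ.2.1 (initSeg t y) * (H.g l t θ.1 x - κ l t)| ≤
      ∑ l, ∑ t, K * |H.g l t θ.1 x - κ l t| := by
    refine (Finset.abs_sum_le_sum_abs _ _).trans (Finset.sum_le_sum fun l _ => ?_)
    refine (Finset.abs_sum_le_sum_abs _ _).trans (Finset.sum_le_sum fun t _ => ?_)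
    rw [abs_mul]
    exact mul_le_mul_of_nonneg_right (hK l t _ hθ2 _) (abs_nonneg _)
  exact (abs_add_le _ _).trans (add_le_add ((abs_sub _ _).trans (add_le_add (hf y) h1)) h2)

theorem abs_innerSup_le (hab : a < b) (hf : ∀ y, |f y| ≤ Bf) (hc : ∀ x y, |c x y| ≤ Bc)
    (hK : ∀ l t, ∀ θ ∈ H.C, ∀ y, |H.h l t θ y| ≤ K)
    {θ : (Fin H.m → ℝ) × (Fin H.m → ℝ) × ℝ} (hθ : θ ∈ H.params) (x : Path a b d T)
    (κ : Fin H.L → Fin (T - 1) → ℝ) :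
    |innerSup f c H θ x κ| ≤
      Bf + H.lamMax * Bc + ∑ l, ∑ t, K * |H.g l t θ.1 x - κ l t| := by
  obtain ⟨y0⟩ := nonempty_path (d := d) (T := T) hab
  have : Nonempty (Path a b d T) := ⟨y0⟩
  have h := abs_dual_integrand_le hf hc hK hθ x κ
  rw [abs_le]
  constructor
  · exact (abs_le.1 (h y0)).1.trans
      (le_ciSup ⟨_, by rintro _ ⟨y, rfl⟩; exact (abs_le.1 (h y)).2⟩ y0)
  · exact ciSup_le fun y => (abs_le.1 (h y)).2

theorem abs_innerSup_sub_le (hab : a < b) (hf : ∀ y, |f y| ≤ Bf) (hc : ∀ x y, |c x y| ≤ Bc)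
    (hK : ∀ l t, ∀ θ ∈ H.C, ∀ y, |H.h l t θ y| ≤ K)
    {θ : (Fin H.m → ℝ) × (Fin H.m → ℝ) × ℝ} (hθ : θ ∈ H.params) (x : Path a b d T)
    (κ κ' : Fin H.L → Fin (T - 1) → ℝ) :
    |innerSup f c H θ x κ - innerSup f c H θ x κ'| ≤ ∑ l, ∑ t, K * |κ l t - κ' l t| := by
  have : Nonempty (Path a b d T) := nonempty_path hab
  have key : ∀ κ κ' : Fin H.L → Fin (T - 1) → ℝ,
      innerSup f c H θ x κ ≤ innerSup f c H θ x κ' + ∑ l, ∑ t, K * |κ l t - κ' l t| := by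
    intro κ κ'
    refine ciSup_le fun y => ?_
    refine le_trans ?_ (add_le_add_left
      (le_ciSup ⟨_, by
        rintro _ ⟨y, rfl⟩
        exact (abs_le.1 (abs_dual_integrand_le hf hc hK hθ x κ' y)).2⟩ y) _)
    rw [add_assoc, ← Finset.sum_add_distrib]
    refine add_le_add_right (Finset.sum_le_sum fun l _ => ?_) _
    rw [← Finset.sum_add_distrib]
    refine Finset.sum_le_sum fun t _ => ?_
    have h1 : H.h l t θ.2.1 (initSeg t y) * (κ' l t - κ l t) ≤ K * |κ l t - κ' l t| := by
      refine (le_abs_self _).trans ?_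
      rw [abs_mul, abs_sub_comm]
      exact mul_le_mul_of_nonneg_right (hK l t _ hθ.2.1 _) (abs_nonneg _)
    linarith
  rw [abs_le]
  constructor
  · have h := key κ' κ
    simp only [abs_sub_comm (κ' _ _)] at h
    linarith
  · linarith [key κ κ']

end InnerSup

/-- The conditional means that enter `quantF`, in terms of the encoded path. -/
def trueMeans (hab : a < b) (H : HypothesisSet a b d T) (μ : Measure (Path a b d T)) {N : ℕ}
    (hM : 0 < cellsPerAxis d T N) (θ : Fin H.m → ℝ) (e : Fin T → Fin d → Fin (cellsPerAxis d T N))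
    (l : Fin H.L) (t : Fin (T - 1)) : ℝ :=
  condMean (codeWeight μ (encodePath hM)) (codePrefix hM t)
    (fun e' => H.g l t θ (decodePath hab hM e')) (codePrefix hM t e)

theorem quantF_eq (hab : a < b) (f : Path a b d T → ℝ) (c : Path a b d T → Path a b d T → ℝ)
    (H : HypothesisSet a b d T) (μ : Measure (Path a b d T)) [IsProbabilityMeasure μ] {N : ℕ}
    (hM : 0 < cellsPerAxis d T N) (θ : (Fin H.m → ℝ) × (Fin H.m → ℝ) × ℝ) (x : Path a b d T) :
    quantF f c H μ N θ x =
      innerSup f c H θ (quant N x) (trueMeans hab H μ hM θ.1 (encodePath hM x)) := by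
  unfold quantF
  congr 1
  funext l t
  exact integral_cond_cell_eq hab μ hM t (H.g l t θ.1) x

theorem dualAdapted_eq (hab : a < b) (f : Path a b d T → ℝ)
    (c : Path a b d T → Path a b d T → ℝ) (H : HypothesisSet a b d T) {N : ℕ}
    (hM : 0 < cellsPerAxis d T N) (X : Fin N → Path a b d T)
    (θ : (Fin H.m → ℝ) × (Fin H.m → ℝ) × ℝ) (ε : ℝ) :
    dualAdapted f c H N X θ ε = (N : ℝ)⁻¹ * ∑ n, innerSup f c H θ (quant N (X n)) (fun l t =>
      cellAverage (fun k => codePrefix hM t (encodePath hM (X k)))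
        (fun k => H.g l t θ.1 (quant N (X k))) (codePrefix hM t (encodePath hM (X n))))
      + θ.2.2 * ε := by
  rw [dualAdapted, integral_adaptedEmpirical X fun x => innerSup f c H θ x _]
  simp only [integral_adaptedConditional_cell hab hM]

theorem decodePath_invariant_classG (hab : a < b) (H : HypothesisSet a b d T) {N : ℕ}
    (hM : 0 < cellsPerAxis d T N) :
    ∀ u ∈ classG H N, ∀ x, u (decodePath hab hM (encodePath hM x)) = u x := by
  rintro u ⟨l, t, θ, -, rfl⟩ x
  rw [← quant_eq hab hM]
  dsimp only
  rw [quant_quant hab hM]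

theorem decodePath_invariant_classF (hab : a < b) (f : Path a b d T → ℝ)
    (c : Path a b d T → Path a b d T → ℝ) (H : HypothesisSet a b d T)
    (μ : Measure (Path a b d T)) [IsProbabilityMeasure μ] {N : ℕ}
    (hM : 0 < cellsPerAxis d T N) :
    ∀ u ∈ classF f c H μ N, ∀ x, u (decodePath hab hM (encodePath hM x)) = u x := by
  rintro u ⟨θ, -, rfl⟩ x
  rw [← quant_eq hab hM, quantF_eq hab f c H μ hM, quantF_eq hab f c H μ hM,
    quant_quant hab hM, encodePath_quant hab]

theorem abs_quantF_le (hab : a < b) {f : Path a b d T → ℝ}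
    {c : Path a b d T → Path a b d T → ℝ} {H : HypothesisSet a b d T} {Bf Bc K Cg : ℝ}
    (hf : ∀ y, |f y| ≤ Bf) (hc : ∀ x y, |c x y| ≤ Bc) (hK0 : 0 ≤ K)
    (hK : ∀ l t, ∀ θ ∈ H.C, ∀ y, |H.h l t θ y| ≤ K) (hCg : 0 ≤ Cg)
    (hg : ∀ l t, ∀ θ ∈ H.C, ∀ x, |H.g l t θ x| ≤ Cg)
    (μ : Measure (Path a b d T)) [IsProbabilityMeasure μ] {N : ℕ}
    (hM : 0 < cellsPerAxis d T N) {θ : (Fin H.m → ℝ) × (Fin H.m → ℝ) × ℝ} (hθ : θ ∈ H.params)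
    (x : Path a b d T) :
    |quantF f c H μ N θ x| ≤
      Bf + H.lamMax * Bc + ∑ _l : Fin H.L, ∑ _t : Fin (T - 1), K * (2 * Cg) := by
  rw [quantF_eq hab f c H μ hM]
  refine (abs_innerSup_le hab hf hc hK hθ _ _).trans ?_
  refine add_le_add_right (Finset.sum_le_sum fun l _ => Finset.sum_le_sum fun t _ =>
    mul_le_mul_of_nonneg_left ?_ hK0) _
  have h1 : |trueMeans hab H μ hM θ.1 (encodePath hM x) l t| ≤ Cg :=
    abs_condMean_le (codeWeight_nonneg μ _) _ hCg (fun e => hg l t _ hθ.1 _) _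
  linarith [abs_sub (H.g l t θ.1 (quant N x)) (trueMeans hab H μ hM θ.1 (encodePath hM x) l t),
    hg l t _ hθ.1 (quant N x)]

/-- The error of the dual objective splits into the deviation of the empirical mean of `F_θ` and
the mean deviation of the empirical conditional expectations, the inner supremum being Lipschitz
in the latter. Both are controlled outside the deviation events. -/
theorem abs_dualTrue_sub_dualAdapted_le (hab : a < b) {f : Path a b d T → ℝ}
    {c : Path a b d T → Path a b d T → ℝ} {H : HypothesisSet a b d T} {Bf Bc K Cg B L : ℝ}
    (hf : ∀ y, |f y| ≤ Bf) (hc : ∀ x y, |c x y| ≤ Bc) (hK0 : 0 ≤ K)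
    (hK : ∀ l t, ∀ θ ∈ H.C, ∀ y, |H.h l t θ y| ≤ K) (hCg : 0 ≤ Cg)
    (hg : ∀ l t, ∀ θ ∈ H.C, ∀ x, |H.g l t θ x| ≤ Cg)
    (μ : Measure (Path a b d T)) [IsProbabilityMeasure μ] {N : ℕ} (hN : 0 < N)
    (hM : 0 < cellsPerAxis d T N) (hB : 0 ≤ B) (hFB : ∀ u ∈ classF f c H μ N, ∀ x, |u x| ≤ B)
    {X : Fin N → Path a b d T}
    (hXF : ∀ s, X ∉ deviationEvent μ (encodePath hM) (decodePath hab hM) (classF f c H μ N) B L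
      (fun _ => ()) s N)
    (hXG : ∀ t s, X ∉ deviationEvent μ (encodePath hM) (decodePath hab hM) (classG H N) Cg L
      (codePrefix hM t) s N)
    {θ : (Fin H.m → ℝ) × (Fin H.m → ℝ) × ℝ} (hθ : θ ∈ H.params) (ε : ℝ) :
    |dualTrue f c H μ N θ ε - dualAdapted f c H N X θ ε| ≤
      (2 * rademacher μ (classF f c H μ N) N + B * Real.sqrt (32 * L / N)) +
      H.L * ((T - 1 : ℕ) : ℝ) * K *
        (2 * rademacher μ (classG H N) N + Cg * Real.sqrt (32 * L / N)) := by
  set avg : Fin N → Fin H.L → Fin (T - 1) → ℝ := fun n l t =>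
    cellAverage (fun k => codePrefix hM t (encodePath hM (X k)))
      (fun k => H.g l t θ.1 (quant N (X k))) (codePrefix hM t (encodePath hM (X n))) with havg
  set tm : Fin N → Fin H.L → Fin (T - 1) → ℝ := fun n =>
    trueMeans hab H μ hM θ.1 (encodePath hM (X n)) with htm
  have hF := abs_integral_sub_mean_le μ (measurable_encodePath hM)
    (decodePath_invariant_classF hab f c H μ hM) hB hFB hN hXF ⟨θ, hθ, rfl⟩
  have hG : ∀ l t, (N : ℝ)⁻¹ * ∑ n, |tm n l t - avg n l t| ≤
      2 * rademacher μ (classG H N) N + Cg * Real.sqrt (32 * L / N) := by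
    intro l t
    have h := mean_abs_sub_cellAverage_le μ (decodePath_invariant_classG hab H hM) hCg
      (by rintro u ⟨l, t, θ', hθ', rfl⟩ x; exact hg l t θ' hθ' _) (hXG t)
      (u := fun x => H.g l t θ.1 (quant N x)) ⟨l, t, θ.1, hθ.1, rfl⟩
    simp only [quant_eq hab hM (decodePath hab hM _), encodePath_decodePath] at h
    exact h
  have hsplit : dualTrue f c H μ N θ ε - dualAdapted f c H N X θ ε =
      (∫ x, quantF f c H μ N θ x ∂μ - (N : ℝ)⁻¹ * ∑ n, quantF f c H μ N θ (X n)) +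
      (N : ℝ)⁻¹ * ∑ n, (innerSup f c H θ (quant N (X n)) (tm n) -
        innerSup f c H θ (quant N (X n)) (avg n)) := by
    rw [dualAdapted_eq hab f c H hM, dualTrue, Finset.sum_sub_distrib]
    simp only [quantF_eq hab f c H μ hM]
    ring
  rw [hsplit]
  refine (abs_add_le _ _).trans (add_le_add hF ?_)
  have hN0 : (0 : ℝ) ≤ (N : ℝ)⁻¹ := by positivity
  rw [abs_mul, abs_of_nonneg hN0]
  calc (N : ℝ)⁻¹ * |∑ n, (innerSup f c H θ (quant N (X n)) (tm n) -
        innerSup f c H θ (quant N (X n)) (avg n))|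
      ≤ (N : ℝ)⁻¹ * ∑ n, ∑ l, ∑ t, K * |tm n l t - avg n l t| :=
        mul_le_mul_of_nonneg_left ((Finset.abs_sum_le_sum_abs _ _).trans
          (Finset.sum_le_sum fun n _ => abs_innerSup_sub_le hab hf hc hK hθ _ _ _)) hN0
    _ = ∑ l, ∑ t, K * ((N : ℝ)⁻¹ * ∑ n, |tm n l t - avg n l t|) := by
        rw [Finset.sum_comm, Finset.mul_sum]
        refine Finset.sum_congr rfl fun l _ => ?_
        rw [Finset.sum_comm, Finset.mul_sum]
        refine Finset.sum_congr rfl fun t _ => ?_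
        rw [← Finset.mul_sum]
        ring
    _ ≤ ∑ _l : Fin H.L, ∑ _t : Fin (T - 1),
          K * (2 * rademacher μ (classG H N) N + Cg * Real.sqrt (32 * L / N)) :=
        Finset.sum_le_sum fun l _ => Finset.sum_le_sum fun t _ =>
          mul_le_mul_of_nonneg_left (hG l t) hK0
    _ = _ := by
        simp only [Finset.sum_const, Finset.card_univ, Fintype.card_fin, nsmul_eq_mul]
        ring

end Dual

/-! ### Cell counts and the confidence level -/

section Rates

variable {d T N : ℕ}

theorem qExp_nonneg (d T : ℕ) : 0 ≤ qExp d T := by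
  unfold qExp
  split_ifs <;> positivity

theorem cellsPerAxis_pos (hN : 1 ≤ N) : 0 < cellsPerAxis d T N :=
  Nat.floor_pos.2 (Real.one_le_rpow (by exact_mod_cast hN) (qExp_nonneg d T))

theorem effSize_pos (hN : 1 ≤ N) : 0 < effSize d T N :=
  Real.rpow_pos_of_pos (by exact_mod_cast hN) _

theorem effSize_le (hT : 1 ≤ T) (hN : 1 ≤ N) : effSize d T N ≤ N := by
  have hN' : (1 : ℝ) ≤ N := by exact_mod_cast hN
  have hT' : (1 : ℝ) ≤ T := by exact_mod_cast hT
  have h : 0 ≤ qExp d T * (d : ℝ) * ((T : ℝ) - 1) :=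
    mul_nonneg (mul_nonneg (qExp_nonneg d T) (Nat.cast_nonneg d)) (by linarith)
  calc effSize d T N ≤ (N : ℝ) ^ (1 : ℝ) := Real.rpow_le_rpow_of_exponent_le hN' (by linarith)
    _ = N := Real.rpow_one _

/-- There are at most `N / effSize` prefix cells. -/
theorem numCells_mul_effSize_le (hT : 1 ≤ T) (hN : 1 ≤ N) :
    (cellsPerAxis d T N : ℝ) ^ (d * (T - 1)) * effSize d T N ≤ N := by
  have hN' : (0 : ℝ) < N := by exact_mod_cast hN
  have h1 : (cellsPerAxis d T N : ℝ) ≤ (N : ℝ) ^ qExp d T :=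
    Nat.floor_le (Real.rpow_nonneg hN'.le _)
  have hcast : ((d * (T - 1) : ℕ) : ℝ) = (d : ℝ) * ((T : ℝ) - 1) := by
    rw [Nat.cast_mul, Nat.cast_sub hT, Nat.cast_one]
  calc (cellsPerAxis d T N : ℝ) ^ (d * (T - 1)) * effSize d T N
      ≤ ((N : ℝ) ^ qExp d T) ^ (d * (T - 1)) * effSize d T N :=
        mul_le_mul_of_nonneg_right (pow_le_pow_left₀ (Nat.cast_nonneg _) h1 _)
          (effSize_pos hN).le
    _ = (N : ℝ) ^ (1 : ℝ) := by
        rw [← Real.rpow_natCast, ← Real.rpow_mul hN'.le, hcast, effSize, ← Real.rpow_add hN']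
        congr 1
        ring
    _ = N := Real.rpow_one _

/-- The logarithm of the number of deviation events is of the order of the number of cells, which
costs a factor `N / effSize` in the fluctuation term. -/
theorem log_numEvents_div_le (hT : 1 ≤ T) (hN : 1 ≤ N) {δ Λ : ℝ} (hδ : 0 < δ) (hδ1 : δ < 1)
    (hΛ : Real.log (2 / δ) ≤ Λ) :
    Real.log (T * 2 ^ (cellsPerAxis d T N ^ (d * (T - 1))) / δ) / N ≤
      (2 * T + 1) * (Λ / effSize d T N) := by
  have hT' : (1 : ℝ) ≤ T := by exact_mod_cast hT
  have hN' : (0 : ℝ) < N := by exact_mod_cast hN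
  have hm := effSize_pos (d := d) (T := T) hN
  have hK1 : (1 : ℝ) ≤ ((cellsPerAxis d T N ^ (d * (T - 1)) : ℕ) : ℝ) := by
    exact_mod_cast Nat.one_le_pow _ _ (cellsPerAxis_pos (d := d) (T := T) hN)
  have hKm : ((cellsPerAxis d T N ^ (d * (T - 1)) : ℕ) : ℝ) * effSize d T N ≤ N := by
    rw [Nat.cast_pow]
    exact numCells_mul_effSize_le hT hN
  set K := cellsPerAxis d T N ^ (d * (T - 1))
  have hlog2 : (1 : ℝ) / 2 ≤ Real.log 2 := by linarith [Real.log_two_gt_d9]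
  have hlogδ : Real.log δ ≤ 0 := Real.log_nonpos hδ.le hδ1.le
  have h2δ : Real.log (2 / δ) = Real.log 2 - Real.log δ := Real.log_div (by norm_num) hδ.ne'
  have hlogT : Real.log T ≤ T := (Real.log_le_sub_one_of_pos (by linarith)).trans (by linarith)
  have hlogT0 : 0 ≤ Real.log T := Real.log_nonneg hT'
  have hexpand : Real.log (T * 2 ^ K / δ) = Real.log T + K * Real.log 2 - Real.log δ := by
    rw [Real.log_div (by positivity) hδ.ne', Real.log_mul (by positivity) (by positivity),
      Real.log_pow]
  have h1 : Real.log (T * 2 ^ K / δ) ≤ K * ((2 * T + 1) * Λ) := by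
    calc Real.log (T * 2 ^ K / δ) ≤ K * (Real.log T + Real.log 2 - Real.log δ) := by
          rw [hexpand]
          nlinarith
      _ ≤ K * ((2 * T + 1) * Λ) := by
          refine mul_le_mul_of_nonneg_left ?_ (by positivity)
          nlinarith
  have hΛ0 : 0 ≤ Λ := by linarith
  have h2 : (K : ℝ) / N ≤ 1 / effSize d T N := by
    rw [div_le_div_iff₀ hN' hm]
    linarith
  calc Real.log (T * 2 ^ K / δ) / N ≤ K * ((2 * T + 1) * Λ) / N :=
        div_le_div_of_nonneg_right h1 hN'.le
    _ = (K : ℝ) / N * ((2 * T + 1) * Λ) := by ring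
    _ ≤ 1 / effSize d T N * ((2 * T + 1) * Λ) :=
        mul_le_mul_of_nonneg_right h2 (by positivity)
    _ = (2 * T + 1) * (Λ / effSize d T N) := by ring

/-- The monotonicity of `r` bounds the complexity at sample size `N` by that at `effSize`, up to a
fluctuation term. -/
theorem le_of_antitoneOn_rFun (hT : 1 ≤ T) (hN : 1 ≤ N) {ρ : ℝ → ℝ} {Cg δ Λ : ℝ} (hCg : 0 < Cg)
    (hδ : 0 < δ) (hδ1 : δ < 1) (hΛ : Real.log (2 / δ) ≤ Λ)
    (hr : AntitoneOn (rFun ρ Cg δ) (Set.Ioi 0)) :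
    ρ N ≤ ρ (effSize d T N) + Cg * Real.sqrt (Λ / effSize d T N) := by
  have hm := effSize_pos (d := d) (T := T) hN
  have hN' : (0 : ℝ) < N := by exact_mod_cast hN
  have h := hr (Set.mem_Ioi.2 hm) (Set.mem_Ioi.2 hN') (effSize_le hT hN)
  unfold rFun at h
  have h0 : 0 ≤ Real.log (2 / δ) :=
    Real.log_nonneg (by rw [le_div_iff₀ hδ]; linarith)
  have h1 : Real.sqrt (Real.log (2 / δ) / (2 * effSize d T N)) ≤
      Real.sqrt (Λ / effSize d T N) := by
    refine Real.sqrt_le_sqrt ?_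
    rw [div_le_div_iff₀ (by positivity) hm]
    nlinarith [mul_le_mul_of_nonneg_right hΛ hm.le, mul_nonneg h0 hm.le]
  have h2 : 0 ≤ Cg * Real.sqrt (Real.log (2 / δ) / (2 * N)) := by positivity
  have h3 := mul_le_mul_of_nonneg_left h1 hCg.le
  linarith

end Rates

/-- Union bound for two finite families of exceptional events; `S` need not be measurable. -/
theorem le_measureReal_of_forall_notMem {Ω ι κ : Type*} [MeasurableSpace Ω] [Fintype ι] [Fintype κ]
    (P : Measure Ω) [IsProbabilityMeasure P] {A : ι → Set Ω} {A' : κ → Set Ω} {S : Set Ω}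
    (hA : ∀ i, MeasurableSet (A i)) (hA' : ∀ k, MeasurableSet (A' k)) {η : ℝ}
    (hη : ∀ i, P.real (A i) ≤ η) (hη' : ∀ k, P.real (A' k) ≤ η)
    (hS : ∀ ω, (∀ i, ω ∉ A i) → (∀ k, ω ∉ A' k) → ω ∈ S) :
    1 - (Fintype.card ι + Fintype.card κ) * η ≤ P.real S := by
  have hmeas : MeasurableSet ((⋃ i, A i) ∪ ⋃ k, A' k) :=
    (MeasurableSet.iUnion hA).union (MeasurableSet.iUnion hA')
  have h1 : P.real ((⋃ i, A i) ∪ ⋃ k, A' k) ≤ (Fintype.card ι + Fintype.card κ) * η := by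
    refine (measureReal_union_le _ _).trans ?_
    rw [add_mul]
    refine add_le_add ((measureReal_iUnion_fintype_le A).trans ?_)
      ((measureReal_iUnion_fintype_le A').trans ?_)
    · refine (Finset.sum_le_sum fun i _ => hη i).trans_eq ?_
      rw [Finset.sum_const, Finset.card_univ, nsmul_eq_mul]
    · refine (Finset.sum_le_sum fun i _ => hη' i).trans_eq ?_
      rw [Finset.sum_const, Finset.card_univ, nsmul_eq_mul]
  have h2 : P.real ((⋃ i, A i) ∪ ⋃ k, A' k)ᶜ ≤ P.real S := by
    refine measureReal_mono fun ω hω => ?_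
    simp only [Set.mem_compl_iff, Set.mem_union, Set.mem_iUnion, not_or, not_exists] at hω
    exact hS ω hω.1 hω.2
  rw [probReal_compl_eq_one_sub hmeas] at h2
  linarith

end AdaptedCOT

end

theorem lemma1 (a b : ℝ) (hab : a < b) (d T : ℕ) (hd : 1 ≤ d) (hT : 1 ≤ T)
    (f : AdaptedCOT.Path a b d T → ℝ) (hf : Continuous f)
    (c : AdaptedCOT.Path a b d T → AdaptedCOT.Path a b d T → ℝ)
    (hc : Continuous fun p : AdaptedCOT.Path a b d T × AdaptedCOT.Path a b d T => c p.1 p.2)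
    (hc_nonneg : ∀ x y, 0 ≤ c x y)
    (H : AdaptedCOT.HypothesisSet a b d T)
    (Cg : ℝ) (hCg : 0 < Cg) (hg : ∀ l t, ∀ θ ∈ H.C, ∀ x, |H.g l t θ x| ≤ Cg)
    (μ : MeasureTheory.Measure (AdaptedCOT.Path a b d T))
    [MeasureTheory.IsProbabilityMeasure μ] :
    ∃ C : ℝ, 0 < C ∧
      ∀ (N : ℕ) (_ : 1 ≤ N) (δ : ℝ) (_ : 0 < δ) (_ : δ < 1) (ε : ℝ) (ρ : ℝ → ℝ)
        (_ : AdaptedCOT.IsSizeExtension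
          (AdaptedCOT.rademacher μ (AdaptedCOT.classG H N)) ρ)
        (_ : ConcaveOn ℝ (Set.Ici 0) fun x => x * AdaptedCOT.rFun ρ Cg δ x)
        (_ : AntitoneOn (AdaptedCOT.rFun ρ Cg δ) (Set.Ioi 0)),
        1 - δ ≤ (MeasureTheory.Measure.pi fun _ : Fin N => μ).real
          {X | (⨆ θ ∈ H.params,
              ((|AdaptedCOT.dualTrue f c H μ N θ ε - AdaptedCOT.dualAdapted f c H N X θ ε| : ℝ)
                : EReal)) ≤
            ((2 * AdaptedCOT.rademacher μ (AdaptedCOT.classF f c H μ N) N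
              + C * ρ (AdaptedCOT.effSize d T N)
              + C * Real.sqrt
                  (Real.log (2 * ((N : ℝ) * (H.L : ℝ) * ((T : ℝ) - 1) + 1) / δ)
                    / AdaptedCOT.effSize d T N) : ℝ) : EReal)} := by
  open AdaptedCOT in
  obtain ⟨Bf, hBf, hfB⟩ := exists_bound_of_continuous hf
  obtain ⟨Bc, hBc, hcB⟩ := exists_bound_of_continuous hc
  obtain ⟨K, hK, hhK⟩ := exists_bound_h H
  have hcB' : ∀ x y, |c x y| ≤ Bc := fun x y => hcB (x, y)
  have hT' : (1 : ℝ) ≤ T := by exact_mod_cast hT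
  have hlam := H.lamMax_nonneg
  -- a uniform bound for the functions `F_θ`
  set B : ℝ := Bf + H.lamMax * Bc + ∑ _l : Fin H.L, ∑ _t : Fin (T - 1), K * (2 * Cg) with hB
  have hB0 : 0 < B := by positivity
  -- the Lipschitz constant of the inner supremum in the conditional expectations
  set W : ℝ := H.L * ((T - 1 : ℕ) : ℝ) * K with hW
  have hW0 : 0 ≤ W := by positivity
  set S : ℝ := Real.sqrt (32 * (2 * T + 1)) with hS
  have hS0 : 0 ≤ S := Real.sqrt_nonneg _
  refine ⟨2 * W + B * S + W * Cg * (S + 2) + 1, by positivity, ?_⟩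
  intro N hN δ hδ hδ1 ε ρ hρ _ hr
  have hM : 0 < cellsPerAxis d T N := cellsPerAxis_pos hN
  have hm := effSize_pos (d := d) (T := T) hN
  have hN' : (0 : ℝ) < N := by exact_mod_cast hN
  set Λ : ℝ := Real.log (2 * ((N : ℝ) * (H.L : ℝ) * ((T : ℝ) - 1) + 1) / δ) with hΛ
  have hΛδ : Real.log (2 / δ) ≤ Λ := by
    refine Real.log_le_log (by positivity) (div_le_div_of_nonneg_right ?_ hδ.le)
    have : 0 ≤ (N : ℝ) * (H.L : ℝ) * ((T : ℝ) - 1) :=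
      mul_nonneg (by positivity) (by linarith)
    linarith
  set k : ℕ := cellsPerAxis d T N ^ (d * (T - 1)) with hk
  have hk1 : 1 ≤ k := Nat.one_le_pow _ _ hM
  -- `T * 2 ^ k` bounds the number of deviation events
  set L : ℝ := Real.log (T * 2 ^ k / δ) with hL
  have hnum : (1 : ℝ) ≤ T * 2 ^ k / δ := by
    rw [le_div_iff₀ hδ]
    have : (1 : ℝ) ≤ 2 ^ k := one_le_pow₀ (by norm_num)
    nlinarith
  have hL0 : 0 ≤ L := Real.log_nonneg hnum
  have hexp : Real.exp (-L) = δ / (T * 2 ^ k) := by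
    rw [Real.exp_neg, hL, Real.exp_log (by linarith), inv_div]
  have hsqrt : Real.sqrt (32 * L / N) ≤ S * Real.sqrt (Λ / effSize d T N) := by
    rw [hS, ← Real.sqrt_mul (by positivity)]
    refine Real.sqrt_le_sqrt ?_
    have := log_numEvents_div_le (d := d) hT hN hδ hδ1 hΛδ
    calc 32 * L / N = 32 * (L / N) := by ring
      _ ≤ 32 * ((2 * T + 1) * (Λ / effSize d T N)) := by linarith
      _ = 32 * (2 * T + 1) * (Λ / effSize d T N) := by ring
  have hρN : rademacher μ (classG H N) N ≤
      ρ (effSize d T N) + Cg * Real.sqrt (Λ / effSize d T N) := by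
    rw [← hρ.1 N hN]
    exact le_of_antitoneOn_rFun hT hN hCg hδ hδ1 hΛδ hr
  have hρ0 : 0 ≤ ρ (effSize d T N) := hρ.2 _ hm
  have hFB : ∀ u ∈ classF f c H μ N, ∀ x, |u x| ≤ B := by
    rintro u ⟨θ, hθ, rfl⟩ x
    exact abs_quantF_le hab hfB hcB' hK.le hhK hCg.le hg μ hM hθ x
  have henc := measurable_encodePath (a := a) (b := b) (d := d) (T := T) hM
  have hprob := le_measureReal_of_forall_notMem (MeasureTheory.Measure.pi fun _ : Fin N => μ)
    (A := fun s : Unit → ℤˣ => deviationEvent μ (encodePath hM) (decodePath hab hM)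
      (classF f c H μ N) B L (fun _ => ()) s N)
    (A' := fun q : Fin (T - 1) × ((Fin (T - 1) → Fin d → Fin (cellsPerAxis d T N)) → ℤˣ) =>
      deviationEvent μ (encodePath hM) (decodePath hab hM) (classG H N) Cg L
        (codePrefix hM q.1) q.2 N)
    (S := {X | (⨆ θ ∈ H.params,
        ((|dualTrue f c H μ N θ ε - dualAdapted f c H N X θ ε| : ℝ) : EReal)) ≤
      ((2 * rademacher μ (classF f c H μ N) N
        + (2 * W + B * S + W * Cg * (S + 2) + 1) * ρ (effSize d T N)
        + (2 * W + B * S + W * Cg * (S + 2) + 1) * Real.sqrt (Λ / effSize d T N) : ℝ)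
          : EReal)})
    (fun s => measurableSet_deviationEvent μ henc _ _ _ _ _ _ _)
    (fun q => measurableSet_deviationEvent μ henc _ _ _ _ _ _ _)
    (fun s => measureReal_deviationEvent_le μ henc _
      (decodePath_invariant_classF hab f c H μ hM) hB0 hFB hL0 _ _ hN)
    (fun q => measureReal_deviationEvent_le μ henc _ (decodePath_invariant_classG hab H hM) hCg
      (by rintro u ⟨l, t, θ', hθ', rfl⟩ x; exact hg l t θ' hθ' _) hL0 _ _ hN)
    (fun X hXF hXG => by
      refine iSup₂_le fun θ hθ => EReal.coe_le_coe_iff.2 ?_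
      refine (abs_dualTrue_sub_dualAdapted_le hab hfB hcB' hK.le hhK hCg.le hg μ hN hM hB0.le hFB
        hXF (fun t s => hXG (t, s)) hθ ε).trans ?_
      rw [← hW]
      set Q := Real.sqrt (Λ / effSize d T N)
      have hQ0 : 0 ≤ Q := Real.sqrt_nonneg _
      have h1 : B * Real.sqrt (32 * L / N) ≤ B * (S * Q) :=
        mul_le_mul_of_nonneg_left hsqrt hB0.le
      have h2 : W * (2 * rademacher μ (classG H N) N + Cg * Real.sqrt (32 * L / N)) ≤
          W * (2 * (ρ (effSize d T N) + Cg * Q) + Cg * (S * Q)) :=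
        mul_le_mul_of_nonneg_left
          (add_le_add (by linarith) (mul_le_mul_of_nonneg_left hsqrt hCg.le)) hW0
      have h3 : 0 ≤ (B * S + W * Cg * (S + 2) + 1) * ρ (effSize d T N) := by positivity
      have h4 : 0 ≤ (2 * W + 1) * Q := by positivity
      linarith)
  refine le_trans ?_ hprob
  rw [hexp]
  have hcard : ((Fintype.card (Unit → ℤˣ) : ℝ) + (Fintype.card (Fin (T - 1) ×
      ((Fin (T - 1) → Fin d → Fin (cellsPerAxis d T N)) → ℤˣ)) : ℝ)) ≤ T * 2 ^ k := by
    have h1 : Fintype.card (Fin (T - 1) → Fin d → Fin (cellsPerAxis d T N)) = k := by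
      simp [hk, pow_mul]
    rw [Fintype.card_prod, Fintype.card_fun (α := Fin (T - 1) → Fin d → Fin _), h1]
    simp only [Fintype.card_fun, Fintype.card_units_int, Fintype.card_unit, Fintype.card_fin]
    push_cast [Nat.cast_sub hT]
    have h2 : (2 : ℝ) ^ 1 ≤ 2 ^ k := pow_le_pow_right₀ (by norm_num) hk1
    linarith
  have h2 : (0 : ℝ) < T * 2 ^ k := by positivity
  have h3 := mul_le_mul_of_nonneg_right hcard (div_nonneg hδ.le h2.le)
  have h4 : (T : ℝ) * 2 ^ k * (δ / (T * 2 ^ k)) = δ := by field_simp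
  linarith
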